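/- Let $\mathcal{C}$ be a category with finite products, $k$ a field of characteristic $0$, and $H^{\bullet}=\bigoplus_{i\ge 0}H^i:\mathcal{C}^{\mathrm{op}}\to \mathrm{GrVec}_k$ a functor, not identically zero, to $\mathbb{Z}_{\ge 0}$-graded $k$-vector spaces (with graded $k$-linear maps of degree $0$). Assume: 1. every $H^{\bullet}(X)$ carries a cup product, i.e. $k$-bilinear maps $\cup: H^i(X)\times H^j(X)\to H^{i+j}(X)$ that are associative, natural in $X$ (that is, $f^*(a\cup b)=f^*(a)\cup f^*(b)$), and graded commutative, $a\cup b=(-1)^{ij}\,b\cup a$; 2. (Künneth) for all objects $X,Y$ with projections $p_X,p_Y$ of $X\times Y$, the linear map $H^{\bullet}(X)\otimes_k H^{\bullet}(Y)\to H^{\bullet}(X\times Y)$, $a\otimes b\mapsto p_X^*(a)\cup p_Y^*(b)$, is an isomorphism; 3. every $H^i(X)$ is finite-dimensional over $k$. For a graded endomorphism $\psi=\bigoplus_i\psi_i$ of a graded vector space with finite-dimensional pieces put $L_u(\psi)=\sum_{i\ge0}(-u)^i\operatorname{Tr}(\psi_i)\in k[[u]]$. Let $X$ be an object of $\mathcal{C}$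 and let $\phi=\bigoplus_i\phi_i$ be a graded $k$-linear endomorphism of $H^{\bullet}(X)$. For $n\ge1$, let $\phi_{X^n}$ be the graded endomorphism of $H^{\bullet}(X^n)$ with $$p_1^*(a_1)\cup\cdots\cup p_n^*(a_n)\longmapsto p_1^*(\phi(a_1))\cup\cdots\cup p_n^*(\phi(a_n)),$$ where $p_1,\dots,p_n:X^n\to X$ are the projections, and let $\phi_{X^0}=\mathrm{id}$. It commutes with the action of the symmetric group $S_n$ induced by permuting the coordinates of $X^n$, so for every subgroup $G\le S_n$ it restricts to the invariants $H^{\bullet}(X^n)^{G}$. Set $$S(t)=\sum_{n\ge0}L_u\big(\phi_{X^n}|_{H^{\bullet}(X^n)^{S_n}}\big)t^n\in k[[u]][[t]],$$ and let $A_n\le S_n$ be the alternating group. Then $S(-t)$ is invertible in $k[[u]][[t]]$ and $$\sum_{n\ge0}L_u\big(\phi_{X^n}|_{H^{\bullet}(X^n)^{A_n}}\big)t^n=S(t)+\frac{1}{S(-t)}-1-L_u(\phi)\,t .$$ If $\dim_k H^{\bullet}(X)$ is finite, so that $H^i(X)=0$ for all $i>2d$ for some $d$, then for every such $d$ $$\sum_{n\ge0}L_u\big(\phi_{X^n}|_{H^{\bullet}(X^n)^{A_n}}\big)t^n=\prod_{i=0}^{2d}\left(\frac{1}{\det(\mathrm{id}_{H^i(X)}-\phi_iu^it)}\right)^{(-1)^i}+\prod_{i=0}^{2d}\left(\frac{1}{\det(\mathrm{id}_{H^i(X)}+\phi_iu^it)}\right)^{(-1)^{i+1}}-1-L_u(\phi)\,t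 ,$$ where all these determinants are invertible in $k[[u]][[t]]$. -/

import Mathlib

open CategoryTheory CategoryTheory.Limits Opposite
open scoped DirectSum TensorProduct

universe w v u x

namespace KunnethCohomology

noncomputable section

section Iterated

variable {k : Type x} [CommRing k] {A : Type w} [AddCommGroup A] [Module k A]

/-- The iterated product `a₀ · (a₁ · (⋯ · a_m))` of `m + 1` elements, for a bilinear product. -/
def iter (μ : A →ₗ[k] A →ₗ[k] A) : (m : ℕ) → MultilinearMap k (fun _ : Fin (m + 1) => A) A
  | 0 => MultilinearMap.ofSubsingleton k A A (0 : Fin 1) LinearMap.id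
  | m + 1 => LinearMap.uncurryLeft (M := fun _ : Fin (m + 2) => A)
      { toFun := fun a => (μ a).compMultilinearMap (iter μ m)
        map_add' := fun a b => by ext v; simp
        map_smul' := fun c a => by ext v; simp }

theorem iter_zero (μ : A →ₗ[k] A →ₗ[k] A) (v : Fin 1 → A) : iter μ 0 v = v 0 := rfl

theorem iter_succ (μ : A →ₗ[k] A →ₗ[k] A) (m : ℕ) (v : Fin (m + 2) → A) :
    iter μ (m + 1) v = μ (v 0) (iter μ m (fun i => v i.succ)) := rfl

/-- The iterated product of a list. -/
def iterList (μ : A →ₗ[k] A →ₗ[k] A) : List A → A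
  | [] => 0
  | [a] => a
  | a :: b :: l => μ a (iterList μ (b :: l))

theorem iterList_cons (μ : A →ₗ[k] A →ₗ[k] A) (a : A) (l : List A) (hl : l ≠ []) :
    iterList μ (a :: l) = μ a (iterList μ l) := by
  cases l with
  | nil => exact absurd rfl hl
  | cons b l => rfl

theorem iter_eq_iterList (μ : A →ₗ[k] A →ₗ[k] A) (m : ℕ) (v : Fin (m + 1) → A) :
    iter μ m v = iterList μ (List.ofFn v) := by
  induction m with
  | zero => simp [iter_zero, iterList]
  | succ m ih =>
    rw [iter_succ, ih, List.ofFn_succ (f := v), iterList_cons]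
    rw [List.ofFn_succ]
    exact List.cons_ne_nil _ _

/-- Reordering the factors of an iterated product changes it by a sign depending only on the
degrees, hence the same sign for two families with the same degrees. -/
theorem iterList_perm (μ : A →ₗ[k] A →ₗ[k] A) (h : ℕ → A → Prop)
    (hcomm : ∀ i j a b, h i a → h j b → μ a b = (-1 : k) ^ (i * j) • μ b a)
    (hassoc : ∀ a b c, μ (μ a b) c = μ a (μ b c))
    {l l' : List (ℕ × A × A)} (hp : l.Perm l') (hl : ∀ p ∈ l, h p.1 p.2.1 ∧ h p.1 p.2.2) :
    ∃ e : k, iterList μ (l.map fun p => p.2.1) = e • iterList μ (l'.map fun p => p.2.1) ∧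
      iterList μ (l.map fun p => p.2.2) = e • iterList μ (l'.map fun p => p.2.2) := by
  induction hp with
  | nil => exact ⟨1, by simp, by simp⟩
  | @cons p l₁ l₂ hp ih =>
    by_cases h0 : l₁ = []
    · subst h0
      have : l₂ = [] := hp.nil_eq.symm
      subst this
      exact ⟨1, by simp, by simp⟩
    · have h1 : l₂ ≠ [] := fun hh => h0 (by subst hh; exact hp.eq_nil)
      obtain ⟨e, he, he'⟩ := ih fun q hq => hl q (List.mem_cons_of_mem _ hq)
      refine ⟨e, ?_, ?_⟩
      · rw [List.map_cons, List.map_cons, iterList_cons _ _ _ (by simpa using h0),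
          iterList_cons _ _ _ (by simpa using h1), he, map_smul]
      · rw [List.map_cons, List.map_cons, iterList_cons _ _ _ (by simpa using h0),
          iterList_cons _ _ _ (by simpa using h1), he', map_smul]
  | swap p q l =>
    have hq := hl q (by simp)
    have hp := hl p (by simp)
    refine ⟨(-1 : k) ^ (q.1 * p.1), ?_, ?_⟩
    · by_cases h0 : l = []
      · subst h0
        exact hcomm _ _ _ _ hq.1 hp.1
      · rw [List.map_cons, List.map_cons, List.map_cons, List.map_cons,
          iterList_cons _ _ _ (by simp), iterList_cons _ _ _ (by simpa using h0),
          iterList_cons _ _ _ (by simp), iterList_cons _ _ _ (by simpa using h0),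
          ← hassoc, ← hassoc, hcomm _ _ _ _ hq.1 hp.1, map_smul, LinearMap.smul_apply]
    · by_cases h0 : l = []
      · subst h0
        exact hcomm _ _ _ _ hq.2 hp.2
      · rw [List.map_cons, List.map_cons, List.map_cons, List.map_cons,
          iterList_cons _ _ _ (by simp), iterList_cons _ _ _ (by simpa using h0),
          iterList_cons _ _ _ (by simp), iterList_cons _ _ _ (by simpa using h0),
          ← hassoc, ← hassoc, hcomm _ _ _ _ hq.2 hp.2, map_smul, LinearMap.smul_apply]
  | trans h₁ _ ih₁ ih₂ =>
    obtain ⟨e, he, he'⟩ := ih₁ hl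
    obtain ⟨f, hf, hf'⟩ := ih₂ fun q hq => hl q (h₁.mem_iff.mpr hq)
    exact ⟨e * f, by rw [he, hf, smul_smul], by rw [he', hf', smul_smul]⟩

variable (k A) in
/-- The identification `A ⊗ A^{⊗(m+1)} ≃ A^{⊗(m+2)}`. -/
def consEquiv (m : ℕ) :
    A ⊗[k] (⨂[k] _ : Fin (m + 1), A) ≃ₗ[k] ⨂[k] _ : Fin (m + 2), A :=
  (TensorProduct.comm k _ _) ≪≫ₗ
  (TensorProduct.congr (LinearEquiv.refl k _)
    (PiTensorProduct.subsingletonEquiv (R := k) (s := fun _ : PUnit.{1} => A) PUnit.unit).symm) ≪≫ₗ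
  (PiTensorProduct.tmulEquiv k A) ≪≫ₗ
  (PiTensorProduct.reindex k (fun _ => A)
    ((finSuccEquiv (m + 1)).trans (Equiv.optionEquivSumPUnit _)).symm)

theorem consEquiv_tmul (m : ℕ) (a : A) (v : Fin (m + 1) → A) :
    consEquiv k A m (a ⊗ₜ PiTensorProduct.tprod k v) =
      PiTensorProduct.tprod k (Fin.cons a v : Fin (m + 2) → A) := by
  simp only [consEquiv, LinearEquiv.trans_apply, TensorProduct.comm_tmul,
    TensorProduct.congr_tmul, LinearEquiv.refl_apply, PiTensorProduct.subsingletonEquiv_symm_apply',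
    PiTensorProduct.tmulEquiv_apply]
  erw [PiTensorProduct.reindex_tprod]
  congr 1
  ext i
  refine Fin.cases ?_ (fun j => ?_) i <;> simp

end Iterated

variable {C : Type u} [Category.{v} C] {k : Type x} [Field k]

/-- The total space `H^•(X) = ⨁ᵢ Hⁱ(X)`. -/
abbrev Total (H : Cᵒᵖ ⥤ GradedObject ℕ (ModuleCat.{w} k)) (X : C) : Type w :=
  ⨁ i : ℕ, (H.obj (op X) i : Type w)

/-- The pullback `f^* : Hⁱ(Y) → Hⁱ(X)` along `f : X ⟶ Y`. -/
def pullDeg (H : Cᵒᵖ ⥤ GradedObject ℕ (ModuleCat.{w} k)) {X Y : C} (f : X ⟶ Y) (i : ℕ) :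
    H.obj (op Y) i →ₗ[k] H.obj (op X) i :=
  (H.map f.op i).hom

/-- The pullback `f^* : H^•(Y) → H^•(X)` along `f : X ⟶ Y`. -/
def pull (H : Cᵒᵖ ⥤ GradedObject ℕ (ModuleCat.{w} k)) {X Y : C} (f : X ⟶ Y) :
    Total H Y →ₗ[k] Total H X :=
  DirectSum.lmap (pullDeg H f)

/-- A cup product on `H^•`: an associative, graded commutative, natural family of bilinear maps
`Hⁱ(X) × Hʲ(X) → Hⁱ⁺ʲ(X)`. Equalities between elements of `H^{i+j}(X)` and `H^{j+i}(X)`, etc.,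
are stated inside the total space `H^•(X)`. -/
structure CupProduct (H : Cᵒᵖ ⥤ GradedObject ℕ (ModuleCat.{w} k)) where
  /-- the bilinear maps -/
  cup : ∀ (X : C) (i j : ℕ),
    H.obj (op X) i →ₗ[k] H.obj (op X) j →ₗ[k] H.obj (op X) (i + j)
  graded_comm : ∀ (X : C) (i j : ℕ) (a : H.obj (op X) i) (b : H.obj (op X) j),
    (DirectSum.lof k ℕ (fun n => (H.obj (op X) n : Type w)) (i + j) (cup X i j a b)) =
      (-1 : k) ^ (i * j) •
        DirectSum.lof k ℕ (fun n => (H.obj (op X) n : Type w)) (j + i) (cup X j i b a)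
  assoc : ∀ (X : C) (i j l : ℕ) (a : H.obj (op X) i) (b : H.obj (op X) j) (c : H.obj (op X) l),
    (DirectSum.lof k ℕ (fun n => (H.obj (op X) n : Type w)) (i + j + l)
        (cup X (i + j) l (cup X i j a b) c)) =
      DirectSum.lof k ℕ (fun n => (H.obj (op X) n : Type w)) (i + (j + l))
        (cup X i (j + l) a (cup X j l b c))
  natural : ∀ {X Y : C} (f : X ⟶ Y) (i j : ℕ) (a : H.obj (op Y) i) (b : H.obj (op Y) j),
    pullDeg H f (i + j) (cup Y i j a b) = cup X i j (pullDeg H f i a) (pullDeg H f j b)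

variable {H : Cᵒᵖ ⥤ GradedObject ℕ (ModuleCat.{w} k)}

namespace CupProduct

/-- The cup product on the total space, extended bilinearly. -/
def total (c : CupProduct H) (X : C) : Total H X →ₗ[k] Total H X →ₗ[k] Total H X :=
  DirectSum.toModule k ℕ _ fun i =>
    (DirectSum.toModule k ℕ (H.obj (op X) i →ₗ[k] Total H X) fun j =>
      ((c.cup X i j).compr₂
        (DirectSum.lof k ℕ (fun n => (H.obj (op X) n : Type w)) (i + j))).flip).flip

theorem total_lof (c : CupProduct H) (X : C) (i j : ℕ) (a : H.obj (op X) i)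
    (b : H.obj (op X) j) :
    c.total X (DirectSum.lof k ℕ (fun n => (H.obj (op X) n : Type w)) i a)
      (DirectSum.lof k ℕ (fun n => (H.obj (op X) n : Type w)) j b) =
    DirectSum.lof k ℕ (fun n => (H.obj (op X) n : Type w)) (i + j) (c.cup X i j a b) := by
  simp [total, DirectSum.toModule_lof]

/-- The map `H^•(X) ⊗ H^•(Y) → H^•(P)`, `a ⊗ b ↦ p^*(a) ∪ q^*(b)`. -/
def kunneth (c : CupProduct H) {P X Y : C} (p : P ⟶ X) (q : P ⟶ Y) :
    Total H X ⊗[k] Total H Y →ₗ[k] Total H P :=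
  TensorProduct.lift ((c.total P).compl₁₂ (pull H p) (pull H q))

/-- The Künneth formula: for all `X` and `Y`, the map `a ⊗ b ↦ p_X^*(a) ∪ p_Y^*(b)` is an
isomorphism from `H^•(X) ⊗ H^•(Y)` to `H^•(X × Y)`. -/
def Kunneth [HasFiniteProducts C] (c : CupProduct H) : Prop :=
  ∀ X Y : C, Function.Bijective (c.kunneth (prod.fst : X ⨯ Y ⟶ X) (prod.snd : X ⨯ Y ⟶ Y))

end CupProduct

section Pull

theorem pull_lof {X Y : C} (f : X ⟶ Y) (i : ℕ) (a : H.obj (op Y) i) :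
    pull H f (DirectSum.lof k ℕ (fun n => (H.obj (op Y) n : Type w)) i a) =
      DirectSum.lof k ℕ (fun n => (H.obj (op X) n : Type w)) i (pullDeg H f i a) := by
  simp [pull]

theorem pull_id (X : C) (a : Total H X) : pull H (𝟙 X) a = a := by
  ext i
  simp [pull, pullDeg]

theorem pull_comp {X Y Z : C} (f : X ⟶ Y) (g : Y ⟶ Z) (a : Total H Z) :
    pull H (f ≫ g) a = pull H f (pull H g a) := by
  ext i
  simp [pull, pullDeg]

theorem pull_bijective {X Y : C} (f : X ⟶ Y) [IsIso f] : Function.Bijective (pull H f) := by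
  refine Function.bijective_iff_has_inverse.mpr ⟨pull H (inv f), fun a => ?_, fun a => ?_⟩
  · rw [← pull_comp, IsIso.inv_hom_id, pull_id]
  · rw [← pull_comp, IsIso.hom_inv_id, pull_id]

theorem pull_total (c : CupProduct H) {X Y : C} (f : X ⟶ Y) (a b : Total H Y) :
    pull H f (c.total Y a b) = c.total X (pull H f a) (pull H f b) := by
  induction a using DirectSum.induction_on with
  | zero => simp
  | add a a' h h' => simp [h, h']
  | of i a =>
    induction b using DirectSum.induction_on with
    | zero => simp
    | add b b' h h' => simp [h, h']
    | of j b =>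
      change pull H f (c.total Y (DirectSum.lof k ℕ (fun n => (H.obj (op Y) n : Type w)) i a)
        (DirectSum.lof k ℕ (fun n => (H.obj (op Y) n : Type w)) j b)) =
        c.total X (pull H f (DirectSum.lof k ℕ (fun n => (H.obj (op Y) n : Type w)) i a))
          (pull H f (DirectSum.lof k ℕ (fun n => (H.obj (op Y) n : Type w)) j b))
      rw [c.total_lof, pull_lof, pull_lof, pull_lof, c.total_lof, c.natural]

theorem total_assoc (c : CupProduct H) (X : C) (a b d : Total H X) :
    c.total X (c.total X a b) d = c.total X a (c.total X b d) := by
  induction a using DirectSum.induction_on with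
  | zero => simp
  | add a a' h h' => simp [h, h']
  | of i a =>
    induction b using DirectSum.induction_on with
    | zero => simp
    | add b b' h h' => simp [h, h']
    | of j b =>
      induction d using DirectSum.induction_on with
      | zero => simp
      | add d d' h h' => simp [h, h']
      | of l d =>
        change c.total X (c.total X
            (DirectSum.lof k ℕ (fun n => (H.obj (op X) n : Type w)) i a)
            (DirectSum.lof k ℕ (fun n => (H.obj (op X) n : Type w)) j b))
            (DirectSum.lof k ℕ (fun n => (H.obj (op X) n : Type w)) l d) =
          c.total X (DirectSum.lof k ℕ (fun n => (H.obj (op X) n : Type w)) i a)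
            (c.total X (DirectSum.lof k ℕ (fun n => (H.obj (op X) n : Type w)) j b)
            (DirectSum.lof k ℕ (fun n => (H.obj (op X) n : Type w)) l d))
        rw [c.total_lof, c.total_lof, c.total_lof, c.total_lof, c.assoc]

theorem pull_iter (c : CupProduct H) {X Y : C} (f : X ⟶ Y) (m : ℕ)
    (a : Fin (m + 1) → Total H Y) :
    pull H f (iter (c.total Y) m a) = iter (c.total X) m (fun i => pull H f (a i)) := by
  induction m with
  | zero => rfl
  | succ m ih => rw [iter_succ, iter_succ, pull_total, ih]

theorem iter_homogeneous (c : CupProduct H) (X : C) (m : ℕ) (d : Fin (m + 1) → ℕ)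
    (a : ∀ i, H.obj (op X) (d i)) :
    ∃ b, iter (c.total X) m
        (fun i => DirectSum.lof k ℕ (fun n => (H.obj (op X) n : Type w)) (d i) (a i)) =
      DirectSum.lof k ℕ (fun n => (H.obj (op X) n : Type w)) (∑ i, d i) b := by
  induction m with
  | zero =>
    rw [Fin.sum_univ_one]
    exact ⟨a 0, rfl⟩
  | succ m ih =>
    obtain ⟨b, hb⟩ := ih (fun i => d i.succ) (fun i => a i.succ)
    rw [Fin.sum_univ_succ, iter_succ, hb, c.total_lof]
    exact ⟨_, rfl⟩

end Pull

variable [HasFiniteProducts C]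

/-- The power `Xⁿ`. -/
abbrev power (X : C) (n : ℕ) : C := ∏ᶜ fun _ : Fin n => X

/-- The projection `p_i : Xⁿ ⟶ X`. -/
abbrev proj (X : C) (n : ℕ) (i : Fin n) : power X n ⟶ X := Pi.π (fun _ : Fin n => X) i

/-- The endomorphism of `Xⁿ` permuting the coordinates by `g`: it satisfies
`p_i ∘ permMap g = p_{g(i)}`, so that pulling back along it sends
`p_1^*(a_1) ∪ ⋯ ∪ p_n^*(a_n)` to `p_{g(1)}^*(a_1) ∪ ⋯ ∪ p_{g(n)}^*(a_n)`. -/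
def permMap (X : C) (n : ℕ) (g : Equiv.Perm (Fin n)) : power X n ⟶ power X n :=
  Pi.lift fun i => proj X n (g i)

/-- The invariants `Hⁱ(Xⁿ)^G` for a subgroup `G` of the symmetric group. -/
def invariants (H : Cᵒᵖ ⥤ GradedObject ℕ (ModuleCat.{w} k)) (X : C) {n : ℕ}
    (G : Subgroup (Equiv.Perm (Fin n))) (i : ℕ) : Submodule k (H.obj (op (power X n)) i) where
  carrier := {a | ∀ g ∈ G, pullDeg H (permMap X n g) i a = a}
  add_mem' := fun ha hb g hg => by rw [map_add, ha g hg, hb g hg]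
  zero_mem' := fun g _ => map_zero _
  smul_mem' := fun r a ha g hg => by rw [map_smul, ha g hg]

/-- The Künneth map `H^•(X)^{⊗(m+1)} → H^•(X^{m+1})`,
`a_0 ⊗ ⋯ ⊗ a_m ↦ p_0^*(a_0) ∪ ⋯ ∪ p_m^*(a_m)`. -/
def kunnethPower (c : CupProduct H) (X : C) (m : ℕ) :
    (⨂[k] _ : Fin (m + 1), Total H X) →ₗ[k] Total H (power X (m + 1)) :=
  PiTensorProduct.lift
    ((iter (c.total (power X (m + 1))) m).compLinearMap fun i => pull H (proj X (m + 1) i))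

theorem kunnethPower_tprod (c : CupProduct H) (X : C) (m : ℕ) (a : Fin (m + 1) → Total H X) :
    kunnethPower c X m (PiTensorProduct.tprod k a) =
      iter (c.total (power X (m + 1))) m (fun i => pull H (proj X (m + 1) i) (a i)) := by
  simp [kunnethPower]

theorem kunnethPower_bijective (c : CupProduct H) (hK : c.Kunneth) (X : C) (m : ℕ) :
    Function.Bijective (kunnethPower c X m) := by
  induction m with
  | zero =>
    have hiso : IsIso (proj X 1 0) :=
      ⟨Pi.lift fun _ => 𝟙 X, by
        apply Pi.hom_ext
        intro j
        obtain rfl : j = 0 := Subsingleton.elim _ _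
        simp, by simp⟩
    have : kunnethPower c X 0 = (pull H (proj X 1 0)) ∘ₗ
        (PiTensorProduct.subsingletonEquiv (R := k) (s := fun _ : Fin 1 => Total H X) 0).toLinearMap := by
      ext a
      simp [kunnethPower_tprod, iter_zero, PiTensorProduct.subsingletonEquiv_apply_tprod]
    rw [this]
    exact (pull_bijective _).comp (LinearEquiv.bijective _)
  | succ m ih =>
    let tl : power X (m + 2) ⟶ power X (m + 1) := Pi.lift fun i => proj X (m + 2) i.succ
    let e : power X (m + 2) ⟶ X ⨯ power X (m + 1) := prod.lift (proj X (m + 2) 0) tl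
    let e' : X ⨯ power X (m + 1) ⟶ power X (m + 2) :=
      Pi.lift fun i => Fin.cases prod.fst (fun j => prod.snd ≫ proj X (m + 1) j) i
    have he0 : e ≫ prod.fst = proj X (m + 2) 0 := prod.lift_fst _ _
    have he1 : e ≫ prod.snd = tl := prod.lift_snd _ _
    have he0' : e' ≫ proj X (m + 2) 0 = prod.fst := Pi.lift_π _ _
    have he1' : ∀ j : Fin (m + 1), e' ≫ proj X (m + 2) j.succ = prod.snd ≫ proj X (m + 1) j :=
      fun j => Pi.lift_π _ _
    have htl : ∀ j : Fin (m + 1), tl ≫ proj X (m + 1) j = proj X (m + 2) j.succ :=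
      fun j => Pi.lift_π _ _
    have he : IsIso e := by
      refine ⟨e', ?_, ?_⟩
      · apply Pi.hom_ext
        intro j
        refine Fin.cases ?_ (fun j => ?_) j
        · rw [Category.assoc, he0', he0, Category.id_comp]
        · rw [Category.assoc, he1', ← Category.assoc, he1, htl, Category.id_comp]
      · apply Limits.prod.hom_ext
        · rw [Category.assoc, he0, he0', Category.id_comp]
        · rw [Category.assoc, he1, Category.id_comp]
          apply Pi.hom_ext
          intro j
          rw [Category.assoc, htl, he1']
    have h2 : kunnethPower c X (m + 1) ∘ₗ (consEquiv k (Total H X) m).toLinearMap =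
        (pull H e) ∘ₗ (c.kunneth prod.fst prod.snd) ∘ₗ
          (TensorProduct.congr (LinearEquiv.refl k _)
            (LinearEquiv.ofBijective _ ih)).toLinearMap := by
      refine TensorProduct.ext (LinearMap.ext fun a => PiTensorProduct.ext
        (MultilinearMap.ext fun v => ?_))
      change kunnethPower c X (m + 1) (consEquiv k (Total H X) m (a ⊗ₜ PiTensorProduct.tprod k v)) =
        pull H e (c.total _ (pull H prod.fst a)
          (pull H prod.snd (kunnethPower c X m (PiTensorProduct.tprod k v))))
      rw [consEquiv_tmul, kunnethPower_tprod, kunnethPower_tprod, pull_total, ← pull_comp,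
        ← pull_comp, he0, he1, pull_iter, iter_succ]
      simp only [Fin.cons_zero, Fin.cons_succ, ← pull_comp, htl]
    have h3 : Function.Bijective
        (kunnethPower c X (m + 1) ∘ₗ (consEquiv k (Total H X) m).toLinearMap) := by
      rw [h2]
      exact (pull_bijective e).comp ((hK _ _).comp (LinearEquiv.bijective _))
    exact (Function.Bijective.of_comp_iff _ (consEquiv k (Total H X) m).bijective).mp h3

theorem power_hom_ext (c : CupProduct H) (hK : c.Kunneth) (X : C) (m : ℕ) {M : Type w}
    [AddCommGroup M] [Module k M] {F G : Total H (power X (m + 1)) →ₗ[k] M}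
    (h : ∀ (d : Fin (m + 1) → ℕ) (a : ∀ i, H.obj (op X) (d i)),
      F (iter (c.total (power X (m + 1))) m fun i => pull H (proj X (m + 1) i)
        (DirectSum.lof k ℕ (fun n => (H.obj (op X) n : Type w)) (d i) (a i))) =
      G (iter (c.total (power X (m + 1))) m fun i => pull H (proj X (m + 1) i)
        (DirectSum.lof k ℕ (fun n => (H.obj (op X) n : Type w)) (d i) (a i)))) : F = G := by
  have : F ∘ₗ kunnethPower c X m = G ∘ₗ kunnethPower c X m := by
    apply PiTensorProduct.ext
    ext d a
    have := h d a
    rw [← kunnethPower_tprod] at this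
    exact this
  refine LinearMap.ext fun x => ?_
  obtain ⟨y, rfl⟩ := (kunnethPower_bijective c hK X m).2 x
  exact LinearMap.congr_fun this y

/-- The endomorphism `φ_{Xⁿ}` of `H^•(Xⁿ)` induced by a graded endomorphism `φ` of `H^•(X)`: it
corresponds to `φ^{⊗n}` under the Künneth isomorphism `H^•(Xⁿ) ≅ H^•(X)^{⊗n}`. For `n = 0`, where
`H^•(X)^{⊗0} = k`, it is the identity. -/
def powerEnd (c : CupProduct H) (hK : c.Kunneth) {X : C}
    (φ : ∀ i, Module.End k (H.obj (op X) i)) :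
    (n : ℕ) → Total H (power X n) →ₗ[k] Total H (power X n)
  | 0 => LinearMap.id
  | m + 1 => (LinearEquiv.ofBijective _ (kunnethPower_bijective c hK X m)).conj
      (PiTensorProduct.map fun _ => DirectSum.lmap φ)

/-- `φ_{Xⁿ}(p_1^*(a_1) ∪ ⋯ ∪ p_n^*(a_n)) = p_1^*(φ(a_1)) ∪ ⋯ ∪ p_n^*(φ(a_n))`. -/
theorem powerEnd_iter (c : CupProduct H) (hK : c.Kunneth) {X : C}
    (φ : ∀ i, Module.End k (H.obj (op X) i)) (m : ℕ) (a : Fin (m + 1) → Total H X) :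
    powerEnd c hK φ (m + 1)
        (iter (c.total (power X (m + 1))) m fun i => pull H (proj X (m + 1) i) (a i)) =
      iter (c.total (power X (m + 1))) m
        fun i => pull H (proj X (m + 1) i) (DirectSum.lmap φ (a i)) := by
  rw [← kunnethPower_tprod, ← kunnethPower_tprod, powerEnd, LinearEquiv.conj_apply_apply]
  have : (LinearEquiv.ofBijective _ (kunnethPower_bijective c hK X m)).symm
      (kunnethPower c X m (PiTensorProduct.tprod k a)) = PiTensorProduct.tprod k a :=
    (LinearEquiv.ofBijective _ (kunnethPower_bijective c hK X m)).symm_apply_apply _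
  rw [this, PiTensorProduct.map_tprod]
  rfl

/-- `φ_{Xⁿ}` is graded. -/
theorem powerEnd_graded (c : CupProduct H) (hK : c.Kunneth) {X : C}
    (φ : ∀ i, Module.End k (H.obj (op X) i)) (n r : ℕ) (x : Total H (power X n)) :
    powerEnd c hK φ n (DirectSum.lof k ℕ (fun j => (H.obj (op (power X n)) j : Type w)) r (x r)) =
      DirectSum.lof k ℕ (fun j => (H.obj (op (power X n)) j : Type w)) r
        (powerEnd c hK φ n x r) := by
  cases n with
  | zero => rfl
  | succ m =>
    let P : Total H (power X (m + 1)) →ₗ[k] Total H (power X (m + 1)) :=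
      (DirectSum.lof k ℕ (fun j => (H.obj (op (power X (m + 1))) j : Type w)) r) ∘ₗ
        (DirectSum.component k ℕ (fun j => (H.obj (op (power X (m + 1))) j : Type w)) r)
    have hP : ∀ (s : ℕ) (b : H.obj (op (power X (m + 1))) s),
        P (DirectSum.lof k ℕ (fun j => (H.obj (op (power X (m + 1))) j : Type w)) s b) =
          if s = r then
            DirectSum.lof k ℕ (fun j => (H.obj (op (power X (m + 1))) j : Type w)) s b else 0 := by
      intro s b
      by_cases hs : s = r
      · subst hs
        simp only [P, LinearMap.comp_apply, DirectSum.component.lof_self, if_true]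
      · rw [if_neg hs]
        simp only [P, LinearMap.comp_apply]
        rw [DirectSum.component.of, dif_neg hs, map_zero]
    have : powerEnd c hK φ (m + 1) ∘ₗ P = P ∘ₗ powerEnd c hK φ (m + 1) := by
      apply power_hom_ext c hK X m
      intro d a
      rw [LinearMap.comp_apply (powerEnd c hK φ (m + 1)) P,
        LinearMap.comp_apply P (powerEnd c hK φ (m + 1)), powerEnd_iter]
      simp only [DirectSum.lmap_lof]
      have h1 := powerEnd_iter c hK φ m
        (fun i => DirectSum.lof k ℕ (fun n => (H.obj (op X) n : Type w)) (d i) (a i))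
      simp only [DirectSum.lmap_lof] at h1
      simp only [pull_lof] at h1 ⊢
      obtain ⟨b, hb⟩ := iter_homogeneous c (power X (m + 1)) m d
        (fun i => pullDeg H (proj X (m + 1) i) (d i) (a i))
      obtain ⟨b', hb'⟩ := iter_homogeneous c (power X (m + 1)) m d
        (fun i => pullDeg H (proj X (m + 1) i) (d i) (φ (d i) (a i)))
      rw [hb, hb'] at h1
      rw [hb, hb', hP, hP]
      split_ifs
      · exact h1
      · exact map_zero _
    exact LinearMap.congr_fun this x

/-- `φ_{Xⁿ}` commutes with the permutations of the coordinates. -/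
theorem powerEnd_pull_permMap (c : CupProduct H) (hK : c.Kunneth) {X : C}
    (φ : ∀ i, Module.End k (H.obj (op X) i)) (n : ℕ) (g : Equiv.Perm (Fin n))
    (x : Total H (power X n)) :
    powerEnd c hK φ n (pull H (permMap X n g) x) =
      pull H (permMap X n g) (powerEnd c hK φ n x) := by
  cases n with
  | zero => rfl
  | succ m =>
    have : powerEnd c hK φ (m + 1) ∘ₗ pull H (permMap X (m + 1) g) =
        pull H (permMap X (m + 1) g) ∘ₗ powerEnd c hK φ (m + 1) := by
      apply power_hom_ext c hK X m
      intro d a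
      have hg : ∀ i, permMap X (m + 1) g ≫ proj X (m + 1) i = proj X (m + 1) (g i) :=
        fun i => Pi.lift_π _ _
      rw [LinearMap.comp_apply, LinearMap.comp_apply, powerEnd_iter, pull_iter, pull_iter]
      simp only [← pull_comp, hg]
      let t : Fin (m + 1) → Total H X := fun i =>
        DirectSum.lof k ℕ (fun n => (H.obj (op X) n : Type w)) (d i) (a i)
      let w : Fin (m + 1) → ℕ × Total H (power X (m + 1)) × Total H (power X (m + 1)) :=
        fun j => (d (g.symm j), pull H (proj X (m + 1) j) (t (g.symm j)),
          pull H (proj X (m + 1) j) (DirectSum.lmap φ (t (g.symm j))))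
      obtain ⟨e, he, he'⟩ := iterList_perm (c.total (power X (m + 1)))
        (fun r y => ∃ b, y =
          DirectSum.lof k ℕ (fun n => (H.obj (op (power X (m + 1))) n : Type w)) r b)
        (by
          rintro i j _ _ ⟨y, rfl⟩ ⟨z, rfl⟩
          rw [c.total_lof, c.total_lof, c.graded_comm])
        (total_assoc c _) (Equiv.Perm.ofFn_comp_perm g w)
        (by
          intro p hp
          rw [List.mem_ofFn] at hp
          obtain ⟨i, rfl⟩ := hp
          simp only [w, t, Function.comp_apply, DirectSum.lmap_lof, pull_lof]
          exact ⟨⟨_, rfl⟩, ⟨_, rfl⟩⟩)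
      rw [List.map_ofFn, List.map_ofFn, ← iter_eq_iterList, ← iter_eq_iterList] at he he'
      have h1 := powerEnd_iter c hK φ m (fun j => t (g.symm j))
      simp only [w, Function.comp_def, Equiv.symm_apply_apply] at he he'
      rw [he', ← h1, ← map_smul, ← he]
    exact LinearMap.congr_fun this x

/-- The degree `i` component `φ_{Xⁿ,i}` of `φ_{Xⁿ}`, an endomorphism of `Hⁱ(Xⁿ)`. -/
def powerEndDeg (c : CupProduct H) (hK : c.Kunneth) {X : C}
    (φ : ∀ i, Module.End k (H.obj (op X) i)) (n i : ℕ) :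
    Module.End k (H.obj (op (power X n)) i) :=
  (DirectSum.component k ℕ (fun j => (H.obj (op (power X n)) j : Type w)) i) ∘ₗ
    (powerEnd c hK φ n) ∘ₗ
    (DirectSum.lof k ℕ (fun j => (H.obj (op (power X n)) j : Type w)) i)

theorem powerEnd_lof (c : CupProduct H) (hK : c.Kunneth) {X : C}
    (φ : ∀ i, Module.End k (H.obj (op X) i)) (n i : ℕ) (a : H.obj (op (power X n)) i) :
    powerEnd c hK φ n (DirectSum.lof k ℕ (fun j => (H.obj (op (power X n)) j : Type w)) i a) =
      DirectSum.lof k ℕ (fun j => (H.obj (op (power X n)) j : Type w)) i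
        (powerEndDeg c hK φ n i a) := by
  have := powerEnd_graded c hK φ n i
    (DirectSum.lof k ℕ (fun j => (H.obj (op (power X n)) j : Type w)) i a)
  rw [DirectSum.lof_apply] at this
  exact this

theorem powerEndDeg_mem_invariants (c : CupProduct H) (hK : c.Kunneth) {X : C}
    (φ : ∀ i, Module.End k (H.obj (op X) i)) {n : ℕ} (G : Subgroup (Equiv.Perm (Fin n))) (i : ℕ)
    (a : H.obj (op (power X n)) i) (ha : a ∈ invariants H X G i) :
    powerEndDeg c hK φ n i a ∈ invariants H X G i := by
  intro g hg
  apply DirectSum.of_injective (β := fun j => (H.obj (op (power X n)) j : Type w)) i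
  change DirectSum.lof k ℕ (fun j => (H.obj (op (power X n)) j : Type w)) i _ =
    DirectSum.lof k ℕ (fun j => (H.obj (op (power X n)) j : Type w)) i _
  rw [← pull_lof, ← powerEnd_lof, ← powerEnd_pull_permMap, pull_lof, ha g hg]

/-- The restriction of `φ_{Xⁿ}` to the invariants `H^•(Xⁿ)^G`, in degree `i`. -/
def invariantEnd (c : CupProduct H) (hK : c.Kunneth) {X : C}
    (φ : ∀ i, Module.End k (H.obj (op X) i)) {n : ℕ} (G : Subgroup (Equiv.Perm (Fin n))) (i : ℕ) :
    Module.End k (invariants H X G i) :=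
  (powerEndDeg c hK φ n i).restrict (powerEndDeg_mem_invariants c hK φ G i)

/-- The Lefschetz series `L_u(ψ) = ∑ᵢ (-u)ⁱ Tr(ψᵢ)` in `k⟦u⟧` of a graded endomorphism `ψ = ⨁ᵢ ψᵢ`
of a graded vector space with finite-dimensional graded pieces. -/
def lefschetz {V : ℕ → Type w} [∀ i, AddCommGroup (V i)] [∀ i, Module k (V i)]
    (ψ : ∀ i, Module.End k (V i)) : PowerSeries k :=
  PowerSeries.mk fun i => (-1) ^ i * LinearMap.trace k (V i) (ψ i)

/-- The generating function `∑ₙ L_u(φ_{Xⁿ}|_{H^•(Xⁿ)^{Gₙ}}) tⁿ` in `k⟦u⟧⟦t⟧`, for a sequence of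
subgroups `Gₙ ≤ Sₙ`. -/
def genSeries (c : CupProduct H) (hK : c.Kunneth) {X : C}
    (φ : ∀ i, Module.End k (H.obj (op X) i)) (G : ∀ n : ℕ, Subgroup (Equiv.Perm (Fin n))) :
    PowerSeries (PowerSeries k) :=
  PowerSeries.mk fun n => lefschetz (invariantEnd c hK φ (G n))

/-- For an endomorphism `f` of a finite-dimensional `k`-vector space and a scalar `z` of a
commutative `k`-algebra `R`, the determinant `det(id + z f)`, computed over `R`. -/
def detOneAdd {R : Type x} [CommRing R] [Algebra k R] {V : Type w} [AddCommGroup V] [Module k V]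
    (z : R) (f : Module.End k V) : R :=
  LinearMap.det (LinearMap.id + z • f.baseChange R : R ⊗[k] V →ₗ[R] R ⊗[k] V)

end

end KunnethCohomology

/-! The trace of `φ_{Xⁿ}` on `G`-invariants is the average over `g ∈ G` of the traces of `φ_{Xⁿ} ∘
g^*`. By Künneth, words in a homogeneous basis of `H^•(X)` index a basis of `H^•(Xⁿ)`. If `g`
preserves the degrees of a word `f`, then `g^*` permutes the factors up to the Koszul sign, which is
the sign of `g` on the odd positions of `f`; otherwise the diagonal entry at `f` is zero. With
weights `(-u)^deg` the traces become supertraces of the matrix `M = ⨁ uⁱφᵢ`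
(`trace_powerEndDeg_comp_pullDeg`, `coeff_superTrace`).

Write `D(t) = ∑ detSum tⁿ/n! = det(1 + tM)` and `P(t) = ∑ permSum tⁿ/n!`, separately for the odd and
the even part of `M`. Summing supertraces over `g ∈ Sₙ` makes the odd positions of each word
contribute a determinant and the even ones a permanent, so `S(t) = D_odd(-t) P_even(t)`. Twisting by
`sgn g` exchanges the roles and gives `T(t) = P_odd(-t) D_even(t)`. MacMahon's master theorem `D(-t)
P(t) = 1` yields `T(t) S(-t) = 1` (`superSeries_mul`), and also `S(t) D_even(-t) = D_odd(-t)`, the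
product formula. MacMahon itself follows from Muir's identity, which a sign-reversing involution on
subsets proves.

The indicator of `Aₙ` is `(1 + sgn)/2` and `|Aₙ| = n!/2` for `n ≥ 2`, so there the `Aₙ`-coefficient
is that of `S + T`. For `n = 0, 1` one has `Aₙ = Sₙ`, and the surplus coefficients of `T`, namely
`1` and `L_u(φ)`, must be removed. The coefficient at `n = 0` uses that a terminal object has
cohomology `k` in degree `0`.

`H^•(X)` may be infinite-dimensional. All matrix identities are therefore applied to the truncation
to degrees `≤ N`, which determines the series modulo `u^{N+1}`. -/

namespace KunnethCohomology

noncomputable section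

/-! ### Signs of restricted permutations and Muir's identity. -/

section RestrictSign

variable {ι : Type*} [Fintype ι] [DecidableEq ι]

/-- The sign of the restriction of a permutation `g` to a finset stable under `g`, and `0` if the
finset is not stable. -/
def restrictSign (s : Finset ι) (g : Equiv.Perm ι) : ℤ :=
  if h : ∀ x, g x ∈ s ↔ x ∈ s then ((g.subtypePerm h).sign : ℤ) else 0

theorem restrictSign_of_stable {s : Finset ι} {g : Equiv.Perm ι} (h : ∀ x, g x ∈ s ↔ x ∈ s) :
    restrictSign s g = ((g.subtypePerm h).sign : ℤ) := dif_pos h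

theorem restrictSign_of_not_stable {s : Finset ι} {g : Equiv.Perm ι}
    (h : ¬ ∀ x, g x ∈ s ↔ x ∈ s) : restrictSign s g = 0 := dif_neg h

theorem restrictSign_eq_sign_of_forall {s : Finset ι} {g σ : Equiv.Perm ι}
    (h : ∀ x, g x ∈ s ↔ x ∈ s) (hs : ∀ x ∈ s, σ x = g x) (hn : ∀ x ∉ s, σ x = x) :
    restrictSign s g = (σ.sign : ℤ) := by
  rw [restrictSign_of_stable h, ← Equiv.Perm.sign_ofSubtype]
  congr 2
  ext x
  by_cases hx : x ∈ s
  · rw [Equiv.Perm.ofSubtype_subtypePerm_of_mem h hx, hs x hx]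
  · rw [Equiv.Perm.ofSubtype_subtypePerm_of_not_mem h hx, hn x hx]

theorem restrictSign_disjUnion {s t : Finset ι} {g : Equiv.Perm ι} (hst : Disjoint s t)
    (hs : ∀ x, g x ∈ s ↔ x ∈ s) (ht : ∀ x, g x ∈ t ↔ x ∈ t) :
    restrictSign (s ∪ t) g = restrictSign s g * restrictSign t g := by
  have hu : ∀ x, g x ∈ s ∪ t ↔ x ∈ s ∪ t := fun x => by simp [hs, ht]
  rw [restrictSign_eq_sign_of_forall (σ := Equiv.Perm.ofSubtype (g.subtypePerm hs) *
      Equiv.Perm.ofSubtype (g.subtypePerm ht)) hu, restrictSign_of_stable hs,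
      restrictSign_of_stable ht]
  · simp
  · intro x hx
    rw [Equiv.Perm.mul_apply]
    rcases Finset.mem_union.mp hx with hx | hx
    · rw [Equiv.Perm.ofSubtype_subtypePerm_of_not_mem ht (Finset.disjoint_left.mp hst hx),
        Equiv.Perm.ofSubtype_subtypePerm_of_mem hs hx]
    · rw [Equiv.Perm.ofSubtype_subtypePerm_of_mem ht hx,
        Equiv.Perm.ofSubtype_subtypePerm_of_not_mem hs
          (Finset.disjoint_right.mp hst ((ht x).mpr hx))]
  · intro x hx
    rw [Finset.mem_union, not_or] at hx
    rw [Equiv.Perm.mul_apply, Equiv.Perm.ofSubtype_subtypePerm_of_not_mem ht hx.2,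
      Equiv.Perm.ofSubtype_subtypePerm_of_not_mem hs hx.1]

theorem restrictSign_one (s : Finset ι) : restrictSign s (1 : Equiv.Perm ι) = 1 := by
  rw [restrictSign_eq_sign_of_forall (σ := 1) (by simp) (by simp) (by simp), Equiv.Perm.sign_one,
    Units.val_one]

theorem restrictSign_univ (g : Equiv.Perm ι) : restrictSign Finset.univ g = (g.sign : ℤ) :=
  restrictSign_eq_sign_of_forall (by simp) (by simp) (by simp)

theorem sign_eq_restrictSign_mul {s : Finset ι} {g : Equiv.Perm ι} (h : ∀ x, g x ∈ s ↔ x ∈ s) :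
    (g.sign : ℤ) = restrictSign s g * restrictSign sᶜ g := by
  rw [← restrictSign_disjUnion disjoint_compl_right h (by simpa [not_iff_not] using h),
    Finset.union_compl, restrictSign_univ]

open Classical in
/-- The orbit of `i` under `g` has sign `(-1)^(length - 1)`. -/
theorem restrictSign_sameCycle (g : Equiv.Perm ι) (i : ι) :
    (-1 : ℤ) ^ (Finset.univ.filter fun j => g.SameCycle i j).card *
      restrictSign (Finset.univ.filter fun j => g.SameCycle i j) g = -1 := by
  have h : ∀ x, g x ∈ (Finset.univ.filter fun j => g.SameCycle i j) ↔
      x ∈ (Finset.univ.filter fun j => g.SameCycle i j) := fun x => by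
    simp [Equiv.Perm.sameCycle_apply_right]
  rw [restrictSign_eq_sign_of_forall (σ := g.cycleOf i) h]
  -- A fixed point is separated off because `g.cycleOf i` is then trivial and the sign formula for
  -- cycles does not apply.
  · by_cases hi : g i = i
    · have h1 : (Finset.univ.filter fun j => g.SameCycle i j) = {i} := by
        ext j
        simp only [Finset.mem_filter, Finset.mem_univ, true_and, Finset.mem_singleton]
        refine ⟨fun hj => ?_, fun hj => hj ▸ Equiv.Perm.SameCycle.refl _ _⟩
        exact (hj.eq_of_left hi).symm
      rw [h1, Equiv.Perm.cycleOf_eq_one_iff (f := g) |>.mpr hi]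
      simp
    · have h1 : (Finset.univ.filter fun j => g.SameCycle i j) = (g.cycleOf i).support := by
        ext j
        rw [Equiv.Perm.mem_support_cycleOf_iff' hi]
        simp
      rw [h1, (Equiv.Perm.isCycle_cycleOf g hi).sign]
      push_cast
      rw [mul_neg, ← mul_pow]
      simp
  · intro x hx
    exact Equiv.Perm.SameCycle.cycleOf_apply (by simpa using hx)
  · intro x hx
    exact Equiv.Perm.cycleOf_apply_of_not_sameCycle (by simpa using hx)

/-- Sign-reversing involution: fix a point `i` with orbit `o` and toggle `o` in `s`. Adding an orbit
of length `ℓ` multiplies the term by `(-1)^ℓ (-1)^(ℓ-1) = -1`. -/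
theorem sum_neg_one_pow_card_mul_restrictSign [Nonempty ι] (g : Equiv.Perm ι) :
    ∑ s : Finset ι, (-1 : ℤ) ^ s.card * restrictSign s g = 0 := by
  classical
  obtain ⟨i⟩ := ‹Nonempty ι›
  set o : Finset ι := Finset.univ.filter fun j => g.SameCycle i j with ho
  have hio : i ∈ o := by simp [ho, Equiv.Perm.SameCycle.refl]
  have hoS : ∀ x, g x ∈ o ↔ x ∈ o := fun x => by simp [ho, Equiv.Perm.sameCycle_apply_right]
  have hosign : (-1 : ℤ) ^ o.card * restrictSign o g = -1 := restrictSign_sameCycle g i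
  have hstab : ∀ s : Finset ι, (∀ x, g x ∈ symmDiff s o ↔ x ∈ symmDiff s o) ↔
      ∀ x, g x ∈ s ↔ x ∈ s := fun s => by
    refine forall_congr' fun x => ?_
    rw [Finset.mem_symmDiff, Finset.mem_symmDiff, hoS]
    tauto
  -- A stable set is a union of orbits, so a stable `s` missing `i` is disjoint from `o`.
  have hzpow : ∀ s : Finset ι, (∀ x, g x ∈ s ↔ x ∈ s) → ∀ n : ℤ, ∀ x, (g ^ n) x ∈ s ↔ x ∈ s := by
    intro s hs n
    have hs' : ∀ x, g⁻¹ x ∈ s ↔ x ∈ s := fun x => by simpa using (hs (g⁻¹ x)).symm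
    induction n using Int.induction_on with
    | zero => simp
    | succ n ih => intro x; rw [zpow_add, zpow_one, Equiv.Perm.mul_apply, ih, hs]
    | pred n ih => intro x; rw [zpow_sub, zpow_one, Equiv.Perm.mul_apply, ih, hs']
  have key : ∀ s : Finset ι, (∀ x, g x ∈ s ↔ x ∈ s) → i ∉ s →
      (-1 : ℤ) ^ s.card * restrictSign s g +
        (-1 : ℤ) ^ (symmDiff s o).card * restrictSign (symmDiff s o) g = 0 := by
    intro s hs his
    have hd : Disjoint s o := by
      rw [Finset.disjoint_left]
      intro x hx hxo
      obtain ⟨n, rfl⟩ : g.SameCycle i x := by simpa [ho] using hxo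
      exact his ((hzpow s hs n i).mp hx)
    rw [hd.symmDiff_eq_sup, Finset.sup_eq_union, Finset.card_union_of_disjoint hd,
      restrictSign_disjUnion hd hs hoS, pow_add]
    linear_combination ((-1 : ℤ) ^ s.card * restrictSign s g) * hosign
  refine Finset.sum_involution (fun s _ => symmDiff s o) ?_ ?_ (by simp)
    (by intros; exact symmDiff_symmDiff_cancel_right _ _)
  · intro s _
    by_cases hs : ∀ x, g x ∈ s ↔ x ∈ s
    · by_cases his : i ∈ s
      · have := key (symmDiff s o) ((hstab s).mpr hs) (by simp [Finset.mem_symmDiff, his, hio])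
        rw [symmDiff_symmDiff_cancel_right] at this
        rw [add_comm]
        exact this
      · exact key s hs his
    · rw [restrictSign_of_not_stable hs, restrictSign_of_not_stable (mt (hstab s).mp hs)]
      simp
  · intro s _ _ h
    have : o = ∅ := symmDiff_eq_left.mp h
    simp [this] at hio

variable {R : Type*} [CommRing R]

/-- `restrictSign` vanishes off the stabiliser of `s`, which is `Sym(s) × Sym(sᶜ)`, so the sum
factors. The sign sees only the first factor, which becomes a determinant; the second stays a
permanent. -/
theorem sum_restrictSign_mul_prod (s : Finset ι) (N : Matrix ι ι R) :
    ∑ g : Equiv.Perm ι, (restrictSign s g : R) * ∏ i, N (g i) i =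
      (N.submatrix (Subtype.val : {i // i ∈ s} → ι) Subtype.val).det *
      (N.submatrix (Subtype.val : {i // i ∉ s} → ι) Subtype.val).permanent := by
  rw [Matrix.det_apply', Matrix.permanent, Finset.sum_mul_sum, ← Fintype.sum_prod_type']
  symm
  refine Fintype.sum_of_injective (Equiv.Perm.subtypeCongrHom (· ∈ s))
    (Equiv.Perm.subtypeCongrHom_injective _) _ _ ?_ ?_
  · intro g hg
    rw [restrictSign_of_not_stable, Int.cast_zero, zero_mul]
    intro h
    refine hg ⟨(g.subtypePerm h, g.subtypePerm (p := (· ∉ s)) fun x => not_congr (h x)), ?_⟩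
    ext x
    by_cases hx : x ∈ s
    · simp [Equiv.Perm.subtypeCongrHom, Equiv.Perm.subtypeCongr.left_apply _ _ hx]
    · simp [Equiv.Perm.subtypeCongrHom, Equiv.Perm.subtypeCongr.right_apply _ _ hx]
  · rintro ⟨a, b⟩
    have hl : ∀ x : {i // i ∈ s}, (a.subtypeCongr b) x = a x := fun x =>
      Equiv.Perm.subtypeCongr.left_apply_subtype a b x
    have hr : ∀ x : {i // i ∉ s}, (a.subtypeCongr b) x = b x := fun x =>
      Equiv.Perm.subtypeCongr.right_apply_subtype a b x
    have hstab : ∀ x, (a.subtypeCongr b) x ∈ s ↔ x ∈ s := by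
      intro x
      by_cases hx : x ∈ s
      · simp [hl ⟨x, hx⟩, hx]
      · simpa [hr ⟨x, hx⟩, hx] using (b ⟨x, hx⟩).2
    have h1 : restrictSign s (a.subtypeCongr b) = (a.sign : ℤ) := by
      rw [restrictSign_of_stable hstab]
      congr 2
      ext x
      simp [hl]
    change _ = (restrictSign s (a.subtypeCongr b) : R) * ∏ i, N (a.subtypeCongr b i) i
    rw [h1, ← Fintype.prod_subtype_mul_prod_subtype (· ∈ s)]
    simp only [hl, hr, Matrix.submatrix_apply]
    rw [mul_assoc]
    congr!

/-- On the stabiliser of `s` the full sign is the product of the signs on `s` and `sᶜ`. The two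
signs on `s` cancel, leaving the previous lemma for `sᶜ`. -/
theorem sum_sign_mul_restrictSign_mul_prod (s : Finset ι) (N : Matrix ι ι R) :
    ∑ g : Equiv.Perm ι, (g.sign : ℤ) * (restrictSign s g : R) * ∏ i, N (g i) i =
      (N.submatrix (Subtype.val : {i // i ∈ s} → ι) Subtype.val).permanent *
      (N.submatrix (Subtype.val : {i // i ∉ s} → ι) Subtype.val).det := by
  have h1 : ∀ g : Equiv.Perm ι, (g.sign : ℤ) * restrictSign s g = restrictSign sᶜ g := by
    intro g
    by_cases h : ∀ x, g x ∈ s ↔ x ∈ s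
    · rw [sign_eq_restrictSign_mul h]
      have : restrictSign s g * restrictSign s g = 1 := by
        rw [restrictSign_of_stable h, ← Units.val_mul, Int.units_mul_self, Units.val_one]
      linear_combination restrictSign sᶜ g * this
    · rw [restrictSign_of_not_stable h, restrictSign_of_not_stable (s := sᶜ)]
      · simp
      · simpa [not_iff_not] using h
  have h2 := sum_restrictSign_mul_prod sᶜ N
  simp only [← h1, Int.cast_mul] at h2
  rw [h2, mul_comm]
  let e : {i // i ∈ sᶜ} ≃ {i // i ∉ s} := Equiv.subtypeEquivRight (by simp)
  let e' : {i // i ∉ sᶜ} ≃ {i // i ∈ s} := Equiv.subtypeEquivRight (by simp)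
  congr 1
  · rw [Matrix.permanent, Matrix.permanent, ← e'.permCongr.sum_comp]
    refine Finset.sum_congr rfl fun σ _ => ?_
    rw [← e'.prod_comp]
    refine Finset.prod_congr rfl fun i _ => ?_
    simp [e']
  · rw [← Matrix.det_submatrix_equiv_self e]
    rfl

/-- An identity of Muir between permanents and determinants of complementary principal
submatrices. -/
theorem sum_neg_one_pow_card_mul_det_mul_permanent [Nonempty ι] (N : Matrix ι ι R) :
    ∑ s : Finset ι, (-1 : R) ^ s.card *
      ((N.submatrix (Subtype.val : {i // i ∈ s} → ι) Subtype.val).det *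
      (N.submatrix (Subtype.val : {i // i ∉ s} → ι) Subtype.val).permanent) = 0 := by
  simp only [← sum_restrictSign_mul_prod, Finset.mul_sum]
  rw [Finset.sum_comm]
  refine Finset.sum_eq_zero fun g _ => ?_
  have := congrArg (Int.cast : ℤ → R) (sum_neg_one_pow_card_mul_restrictSign g)
  push_cast at this
  simp only [← mul_assoc, ← Finset.sum_mul, this, zero_mul]

end RestrictSign

/-! ### Sums of principal minors and permanents, and MacMahon's master theorem. -/

section MinorSums

variable {R B : Type*} [CommRing R] [Fintype B]

/-- The sum of the permanents of all principal submatrices, with repetitions, of size `n`. -/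
def permSum (M : Matrix B B R) (n : ℕ) : R := ∑ f : Fin n → B, (M.submatrix f f).permanent

/-- The sum of the determinants of all principal submatrices, with repetitions, of size `n`. -/
def detSum (M : Matrix B B R) (n : ℕ) : R := ∑ f : Fin n → B, (M.submatrix f f).det

theorem permanent_submatrix_equiv_self {ι κ : Type*} [Fintype ι] [DecidableEq ι] [Fintype κ]
    [DecidableEq κ] (e : ι ≃ κ) (N : Matrix κ κ R) :
    (N.submatrix e e).permanent = N.permanent := by
  rw [Matrix.permanent, Matrix.permanent, ← e.permCongr.sum_comp]
  refine Finset.sum_congr rfl fun σ _ => ?_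
  rw [← e.prod_comp]
  simp

theorem permanent_eq_zero_of_row {ι : Type*} [Fintype ι] [DecidableEq ι] {N : Matrix ι ι R}
    (i : ι) (h : ∀ j, N i j = 0) : N.permanent = 0 := by
  refine Finset.sum_eq_zero fun σ _ => Finset.prod_eq_zero (Finset.mem_univ (σ.symm i)) ?_
  simp [h]

theorem sum_permanent_submatrix {ι : Type*} [Fintype ι] [DecidableEq ι] (M : Matrix B B R) :
    ∑ f : ι → B, (M.submatrix f f).permanent = permSum M (Fintype.card ι) := by
  let e := Fintype.equivFin ι
  rw [permSum, ← (e.arrowCongr (Equiv.refl B)).sum_comp]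
  refine Finset.sum_congr rfl fun f _ => ?_
  rw [← permanent_submatrix_equiv_self e]
  congr 1
  ext i j
  simp

theorem sum_det_submatrix {ι : Type*} [Fintype ι] [DecidableEq ι] (M : Matrix B B R) :
    ∑ f : ι → B, (M.submatrix f f).det = detSum M (Fintype.card ι) := by
  let e := Fintype.equivFin ι
  rw [detSum, ← (e.arrowCongr (Equiv.refl B)).sum_comp]
  refine Finset.sum_congr rfl fun f _ => ?_
  rw [← Matrix.det_submatrix_equiv_self e]
  congr 1
  ext i j
  simp

theorem sum_mul_restrict {ι : Type*} [Fintype ι] [DecidableEq ι] (s : Finset ι)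
    (F : ({i // i ∈ s} → B) → R) (G : ({i // i ∉ s} → B) → R) :
    ∑ f : ι → B, F (fun i => f i) * G (fun i => f i) = (∑ f, F f) * ∑ f, G f := by
  rw [Finset.sum_mul_sum, ← Fintype.sum_prod_type',
    ← (Equiv.piEquivPiSubtypeProd (· ∈ s) fun _ => B).sum_comp]
  refine Finset.sum_congr rfl fun f _ => rfl

/-- A word on `Fin n` is a pair of independent words on `s` and `sᶜ`. Two matrices are allowed so
that the odd and even parts can be inserted later. -/
theorem sum_det_mul_permanent {n : ℕ} (s : Finset (Fin n)) (M N : Matrix B B R) :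
    ∑ f : Fin n → B,
      ((M.submatrix f f).submatrix (Subtype.val : {i // i ∈ s} → Fin n) Subtype.val).det *
      ((N.submatrix f f).submatrix (Subtype.val : {i // i ∉ s} → Fin n) Subtype.val).permanent =
    detSum M s.card * permSum N (n - s.card) := by
  have := sum_mul_restrict s (fun f => (M.submatrix f f).det)
    (fun f => (N.submatrix f f).permanent)
  rw [sum_det_submatrix, sum_permanent_submatrix] at this
  simpa [Fintype.card_subtype_compl, Function.comp_def] using this

theorem sum_permanent_mul_det {n : ℕ} (s : Finset (Fin n)) (M N : Matrix B B R) :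
    ∑ f : Fin n → B,
      ((M.submatrix f f).submatrix (Subtype.val : {i // i ∈ s} → Fin n) Subtype.val).permanent *
      ((N.submatrix f f).submatrix (Subtype.val : {i // i ∉ s} → Fin n) Subtype.val).det =
    permSum M s.card * detSum N (n - s.card) := by
  have := sum_mul_restrict s (fun f => (M.submatrix f f).permanent)
    (fun f => (N.submatrix f f).det)
  rw [sum_det_submatrix, sum_permanent_submatrix] at this
  simpa [Fintype.card_subtype_compl, Function.comp_def] using this

variable (k : Type*) [Field k] [Algebra k R]

/-- The exponential generating series `∑ₙ aₙ tⁿ / n!`. -/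
def expSeries (a : ℕ → R) : PowerSeries R :=
  PowerSeries.mk fun n => algebraMap k R (n.factorial : k)⁻¹ * a n

theorem evalNegHom_expSeries (F : ℕ → R) :
    PowerSeries.evalNegHom (expSeries k F) = expSeries k fun n => (-1) ^ n * F n := by
  ext n
  simp only [PowerSeries.evalNegHom, PowerSeries.coeff_rescale, expSeries, PowerSeries.coeff_mk]
  ring

variable [CharZero k]

/-- Binomial convolution of exponential series; the binomial coefficient is absorbed by summing over
subsets instead of sizes. -/
theorem coeff_expSeries_mul (F G : ℕ → R) (n : ℕ) :
    PowerSeries.coeff n (expSeries k F * expSeries k G) =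
      algebraMap k R (n.factorial : k)⁻¹ *
        ∑ s : Finset (Fin n), F s.card * G (n - s.card) := by
  have h := Finset.sum_powerset_apply_card (fun m => F m * G (n - m))
    (x := (Finset.univ : Finset (Fin n)))
  rw [Finset.powerset_univ, Finset.card_univ, Fintype.card_fin] at h
  rw [h, PowerSeries.coeff_mul, Finset.Nat.sum_antidiagonal_eq_sum_range_succ
    (fun i j => PowerSeries.coeff i (expSeries k F) * PowerSeries.coeff j (expSeries k G)),
    Finset.mul_sum]
  refine Finset.sum_congr rfl fun m hm => ?_
  have hm' : m ≤ n := Nat.lt_succ_iff.mp (Finset.mem_range.mp hm)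
  have hc : (m.factorial : k)⁻¹ * ((n - m).factorial : k)⁻¹ =
      (n.factorial : k)⁻¹ * (n.choose m : k) := by
    have h1 := congrArg (Nat.cast : ℕ → k) (Nat.choose_mul_factorial_mul_factorial hm')
    push_cast at h1
    have h2 : (m.factorial : k) ≠ 0 := by exact_mod_cast m.factorial_ne_zero
    have h3 : ((n - m).factorial : k) ≠ 0 := by exact_mod_cast (n - m).factorial_ne_zero
    have h4 : (n.factorial : k) ≠ 0 := by exact_mod_cast n.factorial_ne_zero
    field_simp
    linear_combination -h1
  have hc' := congrArg (algebraMap k R) hc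
  rw [map_mul, map_mul, map_natCast] at hc'
  simp only [expSeries, PowerSeries.coeff_mk, nsmul_eq_mul]
  linear_combination (F m * G (n - m)) * hc'

/-- MacMahon's master theorem, in the form `D(-t) P(t) = 1`. -/
theorem evalNegHom_detSum_mul_permSum (M : Matrix B B R) :
    PowerSeries.evalNegHom (expSeries k (detSum M)) * expSeries k (permSum M) = 1 := by
  ext n
  rw [evalNegHom_expSeries, coeff_expSeries_mul, PowerSeries.coeff_one]
  simp only [mul_assoc, ← sum_det_mul_permanent, Finset.mul_sum]
  rw [Finset.sum_comm]
  split_ifs with hn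
  · subst hn
    simp [Finset.univ_unique, Matrix.permanent, Finset.eq_empty_of_isEmpty]
  · have : Nonempty (Fin n) := ⟨⟨0, Nat.pos_of_ne_zero hn⟩⟩
    refine Finset.sum_eq_zero fun f _ => ?_
    rw [← Finset.mul_sum, sum_neg_one_pow_card_mul_det_mul_permanent, mul_zero]

/-- A word with a repeated letter has determinant zero. The injective words with image `s` are the
`n!` enumerations of `s`, all giving the same minor. -/
theorem detSum_eq [DecidableEq B] (M : Matrix B B R) (n : ℕ) :
    detSum M n = n.factorial * ∑ s ∈ Finset.univ.powersetCard n,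
      (M.submatrix (Subtype.val : {b // b ∈ s} → B) Subtype.val).det := by
  rw [detSum, ← Finset.sum_fiberwise (s := Finset.univ)
    (g := fun f : Fin n → B => Finset.univ.image f), Finset.mul_sum,
    Finset.powersetCard_eq_filter, Finset.powerset_univ, Finset.sum_filter]
  refine Finset.sum_congr rfl fun s _ => ?_
  split_ifs with hs
  · have hcard : Fintype.card (Fin n ≃ {b // b ∈ s}) = n.factorial := by
      rw [Fintype.card_equiv (Fintype.equivOfCardEq (by simp [hs])), Fintype.card_fin]
    rw [← hcard, ← nsmul_eq_mul, ← Finset.card_univ, ← Finset.sum_const]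
    symm
    refine Finset.sum_nbij (fun e i => ((e i : {b // b ∈ s}) : B)) ?_ ?_ ?_ ?_
    · intro e _
      simp only [Finset.mem_filter, Finset.mem_univ, true_and]
      ext b
      simp only [Finset.mem_image, Finset.mem_univ, true_and]
      exact ⟨fun ⟨i, hi⟩ => hi ▸ (e i).2, fun hb => ⟨e.symm ⟨b, hb⟩, by simp⟩⟩
    · intro e _ e' _ h
      ext i
      exact congrFun h i
    · intro f hf
      simp only [Finset.coe_filter, Finset.mem_univ, true_and, Set.mem_ofPred_eq] at hf
      have hmem : ∀ i, f i ∈ s := fun i => hf ▸ Finset.mem_image_of_mem f (Finset.mem_univ i)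
      have hsurj : Function.Surjective fun i => (⟨f i, hmem i⟩ : {b // b ∈ s}) := by
        rintro ⟨b, hb⟩
        rw [← hf] at hb
        obtain ⟨i, -, hi⟩ := Finset.mem_image.mp hb
        exact ⟨i, Subtype.ext hi⟩
      have hbij := (Fintype.bijective_iff_surjective_and_card
        fun i => (⟨f i, hmem i⟩ : {b // b ∈ s})).mpr ⟨hsurj, by simp [hs]⟩
      exact ⟨Equiv.ofBijective _ hbij, Finset.mem_univ _, rfl⟩
    · intro e _
      rw [← Matrix.det_submatrix_equiv_self e]
      rfl
  · refine Finset.sum_eq_zero fun f hf => ?_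
    simp only [Finset.mem_filter, Finset.mem_univ, true_and] at hf
    have : ¬ Function.Injective f := fun h => hs (by
      rw [← hf, Finset.card_image_of_injective _ h, Finset.card_univ, Fintype.card_fin])
    rw [Function.Injective] at this
    push Not at this
    obtain ⟨i, j, hij, hne⟩ := this
    exact Matrix.det_zero_of_row_eq hne (by ext l; simp [hij])

theorem expSeries_detSum [DecidableEq B] (M : Matrix B B R) :
    expSeries k (detSum M) = (1 + (PowerSeries.X : PowerSeries R) • M.map PowerSeries.C).det := by
  -- The expansion of `det(1 + tM)` in principal minors is available for polynomials, so the
  -- determinant is first moved there.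
  have h : ((1 + (Polynomial.X : Polynomial R) • M.map Polynomial.C).det : PowerSeries R) =
      (1 + (PowerSeries.X : PowerSeries R) • M.map PowerSeries.C).det := by
    rw [← Polynomial.coeToPowerSeries.ringHom_apply, RingHom.map_det]
    congr 1
    ext i j : 1
    by_cases hij : i = j <;> simp [hij, mul_comm (PowerSeries.X : PowerSeries R)]
  rw [← h]
  ext n
  rw [Polynomial.coeff_coe, Matrix.coeff_det_one_add_X_smul_eq_sum_minors, expSeries,
    PowerSeries.coeff_mk, detSum_eq, ← mul_assoc, ← map_natCast (algebraMap k R), ← map_mul,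
    inv_mul_cancel₀ (by exact_mod_cast n.factorial_ne_zero), map_one, one_mul]

end MinorSums

/-! ### Supertraces and their factorisation into odd and even parts. -/

section Super

variable {R B : Type*} [CommRing R]

/-- The part of a matrix supported on the indices satisfying `p`. -/
def matrixPart (p : B → Prop) [DecidablePred p] (M : Matrix B B R) : Matrix B B R :=
  Matrix.of fun a b => if p a ∧ p b then M a b else 0

variable (p : B → Prop) [DecidablePred p]

/-- The positions at which a word `f` has an odd letter. -/
def oddPositions {n : ℕ} (f : Fin n → B) : Finset (Fin n) := Finset.univ.filter fun i => p (f i)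

/-- The supertrace of a permutation of the factors composed with a tensor power. -/
def superTrace [Fintype B] (M : Matrix B B R) {n : ℕ} (g : Equiv.Perm (Fin n)) : R :=
  ∑ f : Fin n → B, (-1) ^ (oddPositions p f).card *
    ((restrictSign (oddPositions p f) g : R) * ∏ i, M (f (g i)) (f i))

/-- Any other `s` contains an even position or misses an odd one, and that position gives a zero row
in one of the two factors. This lets a sum over all subsets, hence a convolution, replace the single
subset `oddPositions p f`. -/
theorem det_mul_permanent_eq_zero_of_ne {n : ℕ} (M : Matrix B B R) (f : Fin n → B)
    (s : Finset (Fin n)) (hs : s ≠ oddPositions p f) :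
    (((matrixPart p M).submatrix f f).submatrix
      (Subtype.val : {i // i ∈ s} → Fin n) Subtype.val).det *
    (((matrixPart (fun b => ¬ p b) M).submatrix f f).submatrix
      (Subtype.val : {i // i ∉ s} → Fin n) Subtype.val).permanent = 0 := by
  by_cases h : ∃ i ∈ s, ¬ p (f i)
  · obtain ⟨i, hi, hp⟩ := h
    rw [Matrix.det_eq_zero_of_row_eq_zero ⟨i, hi⟩ (fun j => by simp [matrixPart, hp]), zero_mul]
  · push Not at h
    obtain ⟨i, hi, hp⟩ : ∃ i ∉ s, p (f i) := by
      by_contra! h'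
      exact hs (by ext i; simp only [oddPositions, Finset.mem_filter, Finset.mem_univ, true_and]
                   exact ⟨h i, fun hp => by_contra fun hi => h' i hi hp⟩)
    rw [permanent_eq_zero_of_row ⟨i, hi⟩ (fun j => by simp [matrixPart, hp]), mul_zero]

theorem permanent_mul_det_eq_zero_of_ne {n : ℕ} (M : Matrix B B R) (f : Fin n → B)
    (s : Finset (Fin n)) (hs : s ≠ oddPositions p f) :
    (((matrixPart p M).submatrix f f).submatrix
      (Subtype.val : {i // i ∈ s} → Fin n) Subtype.val).permanent *
    (((matrixPart (fun b => ¬ p b) M).submatrix f f).submatrix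
      (Subtype.val : {i // i ∉ s} → Fin n) Subtype.val).det = 0 := by
  by_cases h : ∃ i ∈ s, ¬ p (f i)
  · obtain ⟨i, hi, hp⟩ := h
    rw [permanent_eq_zero_of_row ⟨i, hi⟩ (fun j => by simp [matrixPart, hp]), zero_mul]
  · push Not at h
    obtain ⟨i, hi, hp⟩ : ∃ i ∉ s, p (f i) := by
      by_contra! h'
      exact hs (by ext i; simp only [oddPositions, Finset.mem_filter, Finset.mem_univ, true_and]
                   exact ⟨h i, fun hp => by_contra fun hi => h' i hi hp⟩)
    rw [Matrix.det_eq_zero_of_row_eq_zero ⟨i, hi⟩ (fun j => by simp [matrixPart, hp]), mul_zero]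

theorem matrixPart_submatrix_odd {n : ℕ} (M : Matrix B B R) (f : Fin n → B) :
    ((matrixPart p M).submatrix f f).submatrix
      (Subtype.val : {i // i ∈ oddPositions p f} → Fin n)
      (Subtype.val : {i // i ∈ oddPositions p f} → Fin n) =
    (M.submatrix f f).submatrix
      (Subtype.val : {i // i ∈ oddPositions p f} → Fin n)
      (Subtype.val : {i // i ∈ oddPositions p f} → Fin n) := by
  ext ⟨i, hi⟩ ⟨j, hj⟩
  simp only [oddPositions, Finset.mem_filter, Finset.mem_univ, true_and] at hi hj
  simp [matrixPart, hi, hj]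

theorem matrixPart_submatrix_even {n : ℕ} (M : Matrix B B R) (f : Fin n → B) :
    ((matrixPart (fun b => ¬ p b) M).submatrix f f).submatrix
      (Subtype.val : {i // i ∉ oddPositions p f} → Fin n)
      (Subtype.val : {i // i ∉ oddPositions p f} → Fin n) =
    (M.submatrix f f).submatrix
      (Subtype.val : {i // i ∉ oddPositions p f} → Fin n)
      (Subtype.val : {i // i ∉ oddPositions p f} → Fin n) := by
  ext ⟨i, hi⟩ ⟨j, hj⟩
  simp only [oddPositions, Finset.mem_filter, Finset.mem_univ, true_and] at hi hj
  simp [matrixPart, hi, hj]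

variable [Fintype B]

/-- For a fixed word, summing over `g` gives the minor at the odd positions times the permanent at
the even ones. The remaining subsets on the right contribute zero. -/
theorem sum_superTrace (M : Matrix B B R) (n : ℕ) :
    ∑ g : Equiv.Perm (Fin n), superTrace p M g =
      ∑ s : Finset (Fin n), (-1) ^ s.card * detSum (matrixPart p M) s.card *
        permSum (matrixPart (fun b => ¬ p b) M) (n - s.card) := by
  simp only [mul_assoc, ← sum_det_mul_permanent, Finset.mul_sum, superTrace]
  rw [Finset.sum_comm, Finset.sum_comm (s := (Finset.univ : Finset (Finset (Fin n))))]
  refine Finset.sum_congr rfl fun f _ => ?_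
  rw [Finset.sum_eq_single (oddPositions p f)
    (fun s _ hs => by rw [det_mul_permanent_eq_zero_of_ne p M f s hs, mul_zero]) (by simp),
    matrixPart_submatrix_odd, matrixPart_submatrix_even, ← sum_restrictSign_mul_prod,
    Finset.mul_sum]
  rfl

/-- The extra sign exchanges determinant and permanent. -/
theorem sum_sign_mul_superTrace (M : Matrix B B R) (n : ℕ) :
    ∑ g : Equiv.Perm (Fin n), ((g.sign : ℤ) : R) * superTrace p M g =
      ∑ s : Finset (Fin n), (-1) ^ s.card * permSum (matrixPart p M) s.card *
        detSum (matrixPart (fun b => ¬ p b) M) (n - s.card) := by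
  simp only [mul_assoc, ← sum_permanent_mul_det, Finset.mul_sum, superTrace]
  rw [Finset.sum_comm, Finset.sum_comm (s := (Finset.univ : Finset (Finset (Fin n))))]
  refine Finset.sum_congr rfl fun f _ => ?_
  rw [Finset.sum_eq_single (oddPositions p f)
    (fun s _ hs => by rw [permanent_mul_det_eq_zero_of_ne p M f s hs, mul_zero]) (by simp),
    matrixPart_submatrix_odd, matrixPart_submatrix_even, ← sum_sign_mul_restrictSign_mul_prod,
    Finset.mul_sum]
  refine Finset.sum_congr rfl fun g _ => ?_
  simp only [Matrix.submatrix_apply]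
  ring

variable (k : Type*) [Field k] [Algebra k R] [CharZero k]

theorem expSeries_sum_superTrace (M : Matrix B B R) :
    expSeries k (fun n => ∑ g : Equiv.Perm (Fin n), superTrace p M g) =
      PowerSeries.evalNegHom (expSeries k (detSum (matrixPart p M))) *
        expSeries k (permSum (matrixPart (fun b => ¬ p b) M)) := by
  ext n
  rw [evalNegHom_expSeries, coeff_expSeries_mul, expSeries, PowerSeries.coeff_mk, sum_superTrace]

theorem expSeries_sum_sign_mul_superTrace (M : Matrix B B R) :
    expSeries k (fun n => ∑ g : Equiv.Perm (Fin n), ((g.sign : ℤ) : R) * superTrace p M g) =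
      PowerSeries.evalNegHom (expSeries k (permSum (matrixPart p M))) *
        expSeries k (detSum (matrixPart (fun b => ¬ p b) M)) := by
  ext n
  rw [evalNegHom_expSeries, coeff_expSeries_mul, expSeries, PowerSeries.coeff_mk,
    sum_sign_mul_superTrace]

end Super

/-! ### Traces on invariants and on graded pieces. -/

section Trace

variable {k : Type*} [Field k]

/-- The trace of an endomorphism on the invariants of a finite group is the average of the traces
of its composites with the group elements. -/
theorem card_mul_trace_restrict_invariants [CharZero k] {V : Type*} [AddCommGroup V] [Module k V]
    [FiniteDimensional k V] {Γ : Type*} [Group Γ] (G : Subgroup Γ) [Fintype G]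
    (ρ : Γ → Module.End k V) (hρ : ∀ g h, ρ (g * h) = ρ g * ρ h) (W : Submodule k V)
    (hW : ∀ v, v ∈ W ↔ ∀ g ∈ G, ρ g v = v) (ψ : Module.End k V) (hψ : ∀ v ∈ W, ψ v ∈ W) :
    (Fintype.card G : k) * LinearMap.trace k W (ψ.restrict hψ) =
      ∑ g : G, LinearMap.trace k V (ψ ∘ₗ ρ g) := by
  have hc : (Fintype.card G : k) ≠ 0 := by exact_mod_cast Fintype.card_ne_zero
  set π : Module.End k V := (Fintype.card G : k)⁻¹ • ∑ g : G, ρ g with hπ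
  have hmem : ∀ v, π v ∈ W := by
    intro v
    rw [hW]
    intro h hh
    simp only [hπ, LinearMap.smul_apply, LinearMap.sum_apply, map_smul, map_sum]
    congr 1
    exact Fintype.sum_equiv (Equiv.mulLeft (⟨h, hh⟩ : G)) _ _ fun g => by simp [hρ]
  have hfix : ∀ v ∈ W, π v = v := by
    intro v hv
    simp only [hπ, LinearMap.smul_apply, LinearMap.sum_apply]
    rw [Finset.sum_congr rfl fun (g : G) _ => (hW v).mp hv g g.2, Finset.sum_const,
      Finset.card_univ, ← Nat.cast_smul_eq_nsmul k, smul_smul, inv_mul_cancel₀ hc, one_smul]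
  -- The average `π` maps into `W` and is the identity there. So `ψ ∘ π` has image in `W` and has
  -- the same trace on `V` as `ψ` on `W`.
  have h1 := LinearMap.trace_restrict_eq_of_forall_mem W (ψ ∘ₗ π) (fun v => hψ _ (hmem v))
  have h2 : (ψ ∘ₗ π).restrict (fun v (_ : v ∈ W) => hψ _ (hmem v)) = ψ.restrict hψ := by
    ext ⟨v, hv⟩
    simp [hfix v hv]
  rw [← h2, h1, hπ, LinearMap.comp_smul, map_smul, smul_eq_mul, mul_inv_cancel_left₀ hc,
    ← Module.End.mul_eq_comp, Finset.mul_sum, map_sum]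
  rfl

/-- The trace of a graded piece of an endomorphism, computed in a homogeneous basis. -/
theorem trace_eq_sum_repr {V : ℕ → Type*} [∀ i, AddCommGroup (V i)] [∀ i, Module k (V i)]
    {I : Type*} (b : Module.Basis I k (⨁ i, V i)) (d : I → ℕ)
    (hb : ∀ f, ∃ v, b f = DirectSum.lof k ℕ V (d f) v) (m : ℕ) (T : Module.End k (⨁ i, V i))
    (Tm : Module.End k (V m))
    (hT : ∀ y, T (DirectSum.lof k ℕ V m y) = DirectSum.lof k ℕ V m (Tm y))
    {J : Type*} [Fintype J] (j : J → I) (hj : Function.Injective j)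
    (hjm : ∀ f, d f = m → f ∈ Set.range j) :
    LinearMap.trace k (V m) Tm =
      ∑ y : {y : J // d (j y) = m}, b.repr (T (b (j y))) (j y) := by
  classical
  have hcomp : ∀ f, d f = m →
      DirectSum.lof k ℕ V m (DirectSum.component k ℕ V m (b f)) = b f := by
    rintro f rfl
    obtain ⟨v, hv⟩ := hb f
    rw [hv, DirectSum.component.lof_self]
  have hcomp' : ∀ f, d f ≠ m → DirectSum.component k ℕ V m (b f) = 0 := by
    intro f hf
    obtain ⟨v, hv⟩ := hb f
    rw [hv, DirectSum.component.of, dif_neg hf]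
  -- The basis vectors of degree `m` form a basis of `V m`. The finite type `J` only has to contain
  -- these, while `I` itself may be infinite.
  let e : {y : J // d (j y) = m} → V m := fun y => DirectSum.component k ℕ V m (b (j y))
  have hli : LinearIndependent k e := by
    refine LinearIndependent.of_comp (DirectSum.lof k ℕ V m) ?_
    have : DirectSum.lof k ℕ V m ∘ e = b ∘ fun y : {y : J // d (j y) = m} => j y := by
      ext1 y
      exact hcomp _ y.2
    rw [this]
    exact b.linearIndependent.comp _ (hj.comp Subtype.val_injective)
  have hspan : ⊤ ≤ Submodule.span k (Set.range e) := by
    intro y _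
    have h1 : ∀ z : ⨁ i, V i, DirectSum.component k ℕ V m z ∈ Submodule.span k (Set.range e) := by
      intro z
      induction b.mem_span z using Submodule.span_induction with
      | mem z hz =>
        obtain ⟨f, rfl⟩ := hz
        by_cases hf : d f = m
        · obtain ⟨y, rfl⟩ := hjm f hf
          exact Submodule.subset_span ⟨⟨y, hf⟩, rfl⟩
        · rw [hcomp' f hf]
          exact Submodule.zero_mem _
      | zero => simp
      | add z z' _ _ h h' => rw [map_add]; exact Submodule.add_mem _ h h'
      | smul a z _ h => rw [map_smul]; exact Submodule.smul_mem _ _ h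
    have := h1 (DirectSum.lof k ℕ V m y)
    rwa [DirectSum.component.lof_self] at this
  let bm := Module.Basis.mk hli hspan
  have hbm : ∀ y, DirectSum.lof k ℕ V m (bm y) = b (j y) := fun y => by
    rw [Module.Basis.mk_apply]
    exact hcomp _ y.2
  have hrepr : ∀ (z : V m) (y : {y : J // d (j y) = m}),
      bm.repr z y = b.repr (DirectSum.lof k ℕ V m z) (j y) := by
    intro z y
    have : (Finsupp.lapply y) ∘ₗ bm.repr.toLinearMap =
        (Finsupp.lapply (j y)) ∘ₗ b.repr.toLinearMap ∘ₗ DirectSum.lof k ℕ V m := by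
      refine bm.ext fun y' => ?_
      simp [hbm, Finsupp.single_apply, hj.eq_iff, Subtype.ext_iff]
    exact LinearMap.congr_fun this z
  rw [LinearMap.trace_eq_matrix_trace k bm, Matrix.trace]
  refine Finset.sum_congr rfl fun y _ => ?_
  rw [Matrix.diag_apply, LinearMap.toMatrix_apply, hrepr, ← hT, hbm]

end Trace

/-! ### The Koszul sign in an associative ring. -/

section KoszulSign

variable {E : Type*} [Ring E]

/-- A pair of elements of the same parity can be exchanged, across a product of homogeneous
elements, at the cost of their own sign. -/
theorem mul_prod_update (P : ℕ → E → Prop)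
    (hP : ∀ i j a b, P i a → P j b → a * b = (-1) ^ (i * j) * (b * a)) (ε : ℕ) {y : E}
    (hy : P ε y) {n : ℕ} (a : Fin n → E) (p : Fin n → ℕ) (ha : ∀ i, P (p i) (a i)) (j : Fin n)
    (hj : p j = ε) :
    y * (List.ofFn a).prod = (-1) ^ ε * (a j * (List.ofFn (Function.update a j y)).prod) := by
  induction n with
  | zero => exact j.elim0
  | succ n ih =>
    have hε : ((-1 : E) ^ (ε * ε)) = (-1) ^ ε := by
      rcases Nat.even_or_odd ε with h | h
      · rw [(h.mul_left ε).neg_one_pow, h.neg_one_pow]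
      · rw [(h.mul h).neg_one_pow, h.neg_one_pow]
    rw [List.ofFn_succ, List.ofFn_succ, List.prod_cons, List.prod_cons]
    induction j using Fin.cases with
    | zero =>
      have h1 := hP ε ε y (a 0) hy (hj ▸ ha 0)
      rw [hε] at h1
      simp only [Function.update_self, ne_eq, Fin.succ_ne_zero, not_false_eq_true,
        Function.update_of_ne]
      rw [← mul_assoc, h1, mul_assoc, mul_assoc]
    | succ j =>
      have h1 := hP ε (p 0) y (a 0) hy (ha 0)
      have h2 := hP ε (p 0) (a j.succ) (a 0) (hj ▸ ha j.succ) (ha 0)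
      have h3 := ih (fun i => a i.succ) (fun i => p i.succ) (fun i => ha _) j hj
      have h4 : (fun i => Function.update a j.succ y i.succ) =
          Function.update (fun i => a i.succ) j y := by
        ext i
        simp [Function.update_apply, Fin.succ_inj]
      have hc : ∀ (q : ℕ) (z : E), Commute z ((-1) ^ q) := fun q z =>
        ((Commute.neg_one_right z).pow_right q)
      -- `y` and `a j.succ` both have parity `ε`, so they pass `a 0` with the same sign, and the two
      -- signs cancel.
      have hs : ((-1 : E) ^ (ε * p 0)) * (-1) ^ (ε * p 0) = 1 := by
        rw [← pow_add, Even.neg_one_pow ⟨_, rfl⟩]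
      rw [h4, Function.update_of_ne (Fin.succ_ne_zero j).symm, ← mul_assoc, h1]
      rw [mul_assoc, mul_assoc, h3]
      rw [← mul_assoc (a j.succ), h2]
      rw [← mul_assoc (a 0), (hc ε (a 0)).eq]
      simp only [mul_assoc]
      rw [← mul_assoc ((-1) ^ (ε * p 0)), (hc ε ((-1) ^ (ε * p 0))).eq, mul_assoc]

theorem prod_comp_swap (P : ℕ → E → Prop)
    (hP : ∀ i j a b, P i a → P j b → a * b = (-1) ^ (i * j) * (b * a)) (ε : ℕ)
    {n : ℕ} (a : Fin n → E) (p : Fin n → ℕ) (ha : ∀ i, P (p i) (a i)) (i j : Fin n)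
    (hij : i < j) (hi : p i = ε) (hj : p j = ε) :
    (List.ofFn (a ∘ Equiv.swap i j)).prod = (-1) ^ ε * (List.ofFn a).prod := by
  induction n with
  | zero => exact i.elim0
  | succ n ih =>
    obtain ⟨j, rfl⟩ : ∃ j', j = Fin.succ j' := ⟨j.pred (Fin.ne_zero_of_lt hij), by simp⟩
    rw [List.ofFn_succ, List.ofFn_succ (f := a), List.prod_cons, List.prod_cons]
    induction i using Fin.cases with
    | zero =>
      rw [mul_prod_update P hP ε (hi ▸ ha 0) (fun i => a i.succ) (fun i => p i.succ)
        (fun i => ha _) j hj]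
      have h1 : (fun i => (a ∘ Equiv.swap 0 j.succ) i.succ) =
          Function.update (fun i => a i.succ) j (a 0) := by
        ext l
        by_cases hl : l = j
        · simp [hl]
        · simp [hl, Equiv.swap_apply_of_ne_of_ne (Fin.succ_ne_zero l)
            (fun h => hl (Fin.succ_injective _ h))]
      rw [h1, ← mul_assoc, ← pow_add, Even.neg_one_pow ⟨_, rfl⟩, one_mul, Function.comp_apply,
        Equiv.swap_apply_left]
    | succ i =>
      have h1 : (fun l => (a ∘ Equiv.swap i.succ j.succ) l.succ) =
          (fun l => a l.succ) ∘ Equiv.swap i j := by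
        ext l
        simp only [Function.comp_apply, (Fin.succ_injective n).swap_apply]
      rw [h1, ih (fun i => a i.succ) (fun i => p i.succ) (fun i => ha _) i j
        (Fin.succ_lt_succ_iff.mp hij) hi hj, Function.comp_apply,
        Equiv.swap_apply_of_ne_of_ne (Fin.succ_ne_zero i).symm (Fin.succ_ne_zero j).symm]
      rw [← mul_assoc, ((Commute.neg_one_right (a 0)).pow_right ε).eq, mul_assoc]

/-- Each transposition inside the class of parity `ε` costs `(-1)^ε`. The induction varies `a`,
since removing a swap replaces `a` by `a ∘ swap`, which has the same parities. -/
theorem prod_comp_ofSubtype (P : ℕ → E → Prop)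
    (hP : ∀ i j a b, P i a → P j b → a * b = (-1) ^ (i * j) * (b * a)) (ε : ℕ)
    {n : ℕ} (p : Fin n → ℕ) (q : Fin n → Prop) [DecidablePred q] (hq : ∀ i, q i → p i = ε)
    (σ : Equiv.Perm {i // q i}) (a : Fin n → E) (ha : ∀ i, P (p i) (a i)) :
    (List.ofFn (a ∘ Equiv.Perm.ofSubtype σ)).prod =
      ((σ.sign ^ ε : ℤˣ) : ℤ) * (List.ofFn a).prod := by
  induction σ using Equiv.Perm.swap_induction_on generalizing a with
  | one => simp
  | swap_mul σ i j hij ih =>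
    rw [map_mul, Equiv.Perm.coe_mul, ← Function.comp_assoc, ih]
    · rw [Equiv.Perm.sign_mul, Equiv.Perm.sign_swap hij, Equiv.Perm.ofSubtype_swap_eq, mul_pow]
      have : (List.ofFn (a ∘ Equiv.swap (i : Fin n) j)).prod = (-1) ^ ε * (List.ofFn a).prod := by
        rcases lt_or_gt_of_ne (Subtype.coe_injective.ne hij) with h | h
        · exact prod_comp_swap P hP ε a p ha i j h (hq _ i.2) (hq _ j.2)
        · rw [Equiv.swap_comm]
          exact prod_comp_swap P hP ε a p ha j i h (hq _ j.2) (hq _ i.2)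
      rw [this, ← mul_assoc]
      push_cast
      rw [((Commute.neg_one_right _).pow_right ε).eq]
    · intro l
      rw [Equiv.Perm.ofSubtype_swap_eq]
      have : p (Equiv.swap (i : Fin n) j l) = p l := by
        by_cases h1 : l = i
        · rw [h1, Equiv.swap_apply_left, hq _ i.2, hq _ j.2]
        · by_cases h2 : l = j
          · rw [h2, Equiv.swap_apply_right, hq _ i.2, hq _ j.2]
          · rw [Equiv.swap_apply_of_ne_of_ne h1 h2]
      rw [← this]
      exact ha _

/-- The Koszul sign of a permutation preserving the parities of the factors. -/
theorem prod_comp_perm (P : ℕ → E → Prop)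
    (hP : ∀ i j a b, P i a → P j b → a * b = (-1) ^ (i * j) * (b * a))
    {n : ℕ} (s : Finset (Fin n)) (g : Equiv.Perm (Fin n)) (hg : ∀ i, g i ∈ s ↔ i ∈ s)
    (a : Fin n → E) (ha : ∀ i, P (if i ∈ s then 1 else 0) (a i)) :
    (List.ofFn (a ∘ g)).prod = (restrictSign s g : E) * (List.ofFn a).prod := by
  -- `g` is split into its action on the odd positions `s`, which produces the sign, and on the even
  -- ones, which is free.
  have h : g = Equiv.Perm.ofSubtype (g.subtypePerm hg) *
      Equiv.Perm.ofSubtype (g.subtypePerm (p := (· ∉ s)) fun x => not_congr (hg x)) := by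
    ext1 i
    rw [Equiv.Perm.mul_apply]
    by_cases hi : i ∈ s
    · rw [Equiv.Perm.ofSubtype_subtypePerm_of_not_mem (p := (· ∉ s)) _ (not_not.mpr hi),
        Equiv.Perm.ofSubtype_subtypePerm_of_mem hg hi]
    · rw [Equiv.Perm.ofSubtype_subtypePerm_of_mem (p := (· ∉ s)) _ hi,
        Equiv.Perm.ofSubtype_subtypePerm_of_not_mem hg (mt (hg i).mp hi)]
  conv_lhs => rw [h, Equiv.Perm.coe_mul, ← Function.comp_assoc]
  rw [prod_comp_ofSubtype P hP 0 (fun i => if i ∈ s then 1 else 0) (· ∉ s) (by simp),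
    prod_comp_ofSubtype P hP 1 (fun i => if i ∈ s then 1 else 0) (· ∈ s) (by simp) _ _ ha,
    restrictSign_of_stable hg]
  · simp only [pow_zero, Units.val_one, Int.cast_one, one_mul, pow_one]
    congr!
  · intro i
    have : Equiv.Perm.ofSubtype (g.subtypePerm hg) i ∈ s ↔ i ∈ s :=
      Equiv.Perm.ofSubtype_apply_mem_iff_mem _ i
    have h2 := ha (Equiv.Perm.ofSubtype (g.subtypePerm hg) i)
    simpa only [this, Function.comp_apply] using h2

end KoszulSign

/-! ### Transfer of the Koszul sign to a non-unital product. -/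

section LeftMul

variable {k : Type x} [CommRing k] {A : Type w} [AddCommGroup A] [Module k A]

/-- Left multiplication by an element of a non-unital algebra `A`, acting on `k × A`. -/
def leftMul (μ : A →ₗ[k] A →ₗ[k] A) : A →ₗ[k] Module.End k (k × A) where
  toFun a := (LinearMap.inr k k A) ∘ₗ (LinearMap.coprod (LinearMap.toSpanSingleton k A a) (μ a))
  map_add' a b := by
    ext <;> simp
  map_smul' r a := by
    ext <;> simp

theorem leftMul_apply (μ : A →ₗ[k] A →ₗ[k] A) (a : A) (y : k × A) :
    leftMul μ a y = (0, y.1 • a + μ a y.2) := by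
  simp [leftMul]

/-- No unit is assumed for the cup product. The added summand `k` supplies one: evaluation at `(1,
0)` recovers the element, so identities can be checked in the ring `Module.End k (k × A)`. -/
theorem leftMul_injective (μ : A →ₗ[k] A →ₗ[k] A) : Function.Injective (leftMul μ) := by
  intro a b h
  have := congrArg Prod.snd (LinearMap.congr_fun h (1, 0))
  simpa [leftMul_apply] using this

theorem leftMul_mul (μ : A →ₗ[k] A →ₗ[k] A) (hassoc : ∀ a b c, μ (μ a b) c = μ a (μ b c))
    (a b : A) : leftMul μ a * leftMul μ b = leftMul μ (μ a b) := by
  refine LinearMap.ext fun y => ?_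
  simp [Module.End.mul_apply, leftMul_apply, hassoc]

theorem leftMul_iter (μ : A →ₗ[k] A →ₗ[k] A) (hassoc : ∀ a b c, μ (μ a b) c = μ a (μ b c))
    (m : ℕ) (a : Fin (m + 1) → A) :
    leftMul μ (iter μ m a) = (List.ofFn fun i => leftMul μ (a i)).prod := by
  induction m with
  | zero => simp [iter_zero]
  | succ m ih => rw [iter_succ, ← leftMul_mul μ hassoc, ih,
      List.ofFn_succ (f := fun i => leftMul μ (a i)), List.prod_cons]

/-- The Koszul sign of a permutation preserving the parities of the factors of an iterated
product. -/
theorem iter_comp_perm (μ : A →ₗ[k] A →ₗ[k] A) (hassoc : ∀ a b c, μ (μ a b) c = μ a (μ b c))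
    (P : ℕ → A → Prop) (hP : ∀ i j a b, P i a → P j b → μ a b = (-1 : k) ^ (i * j) • μ b a)
    (m : ℕ) (s : Finset (Fin (m + 1))) (g : Equiv.Perm (Fin (m + 1)))
    (hg : ∀ i, g i ∈ s ↔ i ∈ s) (a : Fin (m + 1) → A)
    (ha : ∀ i, P (if i ∈ s then 1 else 0) (a i)) :
    iter μ m (a ∘ g) = (restrictSign s g : k) • iter μ m a := by
  apply leftMul_injective μ
  rw [leftMul_iter μ hassoc, map_smul, leftMul_iter μ hassoc]
  refine Eq.trans ?_ ((zsmul_eq_mul _ _).symm.trans (Int.cast_smul_eq_zsmul k _ _).symm)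
  refine prod_comp_perm (fun i y => ∃ a, P i a ∧ y = leftMul μ a) ?_ s g hg
    (fun i => leftMul μ (a i)) (fun i => ⟨_, ha i, rfl⟩)
  rintro i j _ _ ⟨a, ha, rfl⟩ ⟨b, hb, rfl⟩
  rw [leftMul_mul μ hassoc, leftMul_mul μ hassoc, hP i j a b ha hb, map_smul]
  rcases Nat.even_or_odd (i * j) with h | h
  · rw [h.neg_one_pow, one_smul]
    exact ((congrArg (· * leftMul μ (μ b a)) h.neg_one_pow).trans (one_mul _)).symm
  · rw [h.neg_one_pow]
    exact (neg_one_smul k _).trans ((congrArg (· * leftMul μ (μ b a)) h.neg_one_pow).trans (neg_one_mul _)).symm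

end LeftMul

/-! ### Homogeneous bases and matrices of graded endomorphisms. -/

section GradedBasis

variable {k : Type*} [Field k] {V : ℕ → Type*} [∀ i, AddCommGroup (V i)] [∀ i, Module k (V i)]
  {η : ℕ → Type*}

/-- The basis of a direct sum obtained from bases of the summands. -/
def gradedBasis (b : ∀ i, Module.Basis (η i) k (V i)) :
    Module.Basis (Σ i, η i) k (⨁ i, V i) := DFinsupp.basis b

theorem gradedBasis_repr (b : ∀ i, Module.Basis (η i) k (V i)) (y : ⨁ i, V i) (l : Σ i, η i) :
    (gradedBasis b).repr y l = (b l.1).repr (y l.1) l.2 := rfl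

theorem gradedBasis_apply (b : ∀ i, Module.Basis (η i) k (V i)) (l : Σ i, η i) :
    gradedBasis b l = DirectSum.lof k ℕ V l.1 (b l.1 l.2) := by
  classical
  refine (gradedBasis b).ext_elem fun l' => ?_
  rw [Module.Basis.repr_self, gradedBasis_repr]
  obtain ⟨i, y⟩ := l
  obtain ⟨j, z⟩ := l'
  by_cases h : i = j
  · subst h
    rw [DirectSum.lof_apply, Module.Basis.repr_self, Finsupp.single_apply, Finsupp.single_apply]
    simp
  · have : DirectSum.lof k ℕ V i (b i y) j = 0 := DFinsupp.single_eq_of_ne (Ne.symm h)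
    rw [this, map_zero, Finsupp.single_apply, if_neg (fun hh => h (congrArg Sigma.fst hh))]
    rfl

/-- The matrix of a graded endomorphism in a homogeneous basis. -/
def gradedMatrix (b : ∀ i, Module.Basis (η i) k (V i)) (φ : ∀ i, Module.End k (V i)) :
    Matrix (Σ i, η i) (Σ i, η i) k :=
  Matrix.of fun l l' => (gradedBasis b).repr (DirectSum.lmap φ (gradedBasis b l')) l

theorem gradedMatrix_of_ne (b : ∀ i, Module.Basis (η i) k (V i)) (φ : ∀ i, Module.End k (V i))
    {l l' : Σ i, η i} (h : l.1 ≠ l'.1) : gradedMatrix b φ l l' = 0 := by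
  have : DirectSum.lof k ℕ V l'.1 (φ l'.1 (b l'.1 l'.2)) l.1 = 0 := DFinsupp.single_eq_of_ne h
  rw [gradedMatrix, Matrix.of_apply, gradedBasis_apply, DirectSum.lmap_lof, gradedBasis_repr, this,
    map_zero]
  rfl

theorem gradedMatrix_same (b : ∀ i, Module.Basis (η i) k (V i)) (φ : ∀ i, Module.End k (V i))
    (i : ℕ) (y z : η i) : gradedMatrix b φ ⟨i, y⟩ ⟨i, z⟩ = (b i).repr (φ i (b i z)) y := by
  rw [gradedMatrix, Matrix.of_apply, gradedBasis_apply, DirectSum.lmap_lof, gradedBasis_repr,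
    DirectSum.lof_apply]

end GradedBasis

/-! ### Matrix entries of permutations on the cohomology of powers. -/

section PowerTrace

variable {C : Type u} [Category.{v} C] {k : Type x} [Field k]
  {H : Cᵒᵖ ⥤ GradedObject ℕ (ModuleCat.{w} k)} [HasFiniteProducts C]

theorem permMap_mul (X : C) (n : ℕ) (g h : Equiv.Perm (Fin n)) :
    permMap X n (g * h) = permMap X n g ≫ permMap X n h := by
  apply Pi.hom_ext
  intro i
  simp [permMap]

theorem pullDeg_permMap_mul (X : C) (n i : ℕ) (g h : Equiv.Perm (Fin n)) :
    pullDeg H (permMap X n (g * h)) i = pullDeg H (permMap X n g) i * pullDeg H (permMap X n h) i := by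
  rw [permMap_mul]
  ext a
  simp [pullDeg]

/-- Pulling back an exterior product of homogeneous classes along a permutation of the factors
permutes the classes, up to a sign, which is the Koszul sign if the degrees are preserved. -/
theorem pull_permMap_iter (c : CupProduct H) (X : C) (m : ℕ) (g : Equiv.Perm (Fin (m + 1)))
    (d : Fin (m + 1) → ℕ) (a : Fin (m + 1) → Total H X)
    (ha : ∀ i, ∃ b, a i = DirectSum.lof k ℕ (fun n => (H.obj (op X) n : Type w)) (d i) b) :
    ∃ e : k, pull H (permMap X (m + 1) g)
        (iter (c.total (power X (m + 1))) m fun i => pull H (proj X (m + 1) i) (a i)) =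
      e • iter (c.total (power X (m + 1))) m
        (fun i => pull H (proj X (m + 1) i) (a (g.symm i))) ∧
      ((∀ i, d (g i) = d i) →
        e = restrictSign (Finset.univ.filter fun i => Odd (d i)) g) := by
  have hg : ∀ i, permMap X (m + 1) g ≫ proj X (m + 1) i = proj X (m + 1) (g i) :=
    fun i => Pi.lift_π _ _
  rw [pull_iter]
  simp only [← pull_comp, hg]
  let y : Fin (m + 1) → Total H (power X (m + 1)) :=
    fun j => pull H (proj X (m + 1) j) (a (g.symm j))
  have hy : ∀ j, ∃ b, y j =
      DirectSum.lof k ℕ (fun n => (H.obj (op (power X (m + 1))) n : Type w)) (d (g.symm j)) b := by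
    intro j
    obtain ⟨b, hb⟩ := ha (g.symm j)
    exact ⟨_, by rw [← pull_lof, ← hb]⟩
  have hyg : (fun i => pull H (proj X (m + 1) (g i)) (a i)) = y ∘ g := by
    ext1 i
    simp [y]
  rw [hyg]
  change ∃ e : k, _ = e • iter (c.total (power X (m + 1))) m y ∧ _
  by_cases hd : ∀ i, d (g i) = d i
  · refine ⟨_, iter_comp_perm (c.total (power X (m + 1))) (total_assoc c _)
      -- Homogeneity is weakened to parity, the only datum on which the Koszul sign depends.
      (fun ε z => ∃ r b, r % 2 = ε % 2 ∧
        z = DirectSum.lof k ℕ (fun n => (H.obj (op (power X (m + 1))) n : Type w)) r b)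
      ?_ m (Finset.univ.filter fun i => Odd (d i)) g (fun i => by simp [hd]) y ?_, fun _ => rfl⟩
    · rintro i j _ _ ⟨r, b, hr, rfl⟩ ⟨r', b', hr', rfl⟩
      rw [c.total_lof, c.total_lof, c.graded_comm]
      congr 1
      rw [neg_one_pow_eq_pow_mod_two (n := r * r'), neg_one_pow_eq_pow_mod_two (n := i * j),
        Nat.mul_mod, hr, hr', ← Nat.mul_mod]
    · intro j
      obtain ⟨b, hb⟩ := hy j
      have h1 : d (g.symm j) = d j := by rw [← hd (g.symm j), Equiv.apply_symm_apply]
      refine ⟨d (g.symm j), b, ?_, hb⟩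
      rw [h1]
      by_cases h2 : Odd (d j)
      · simp [h2, Nat.odd_iff.mp h2]
      · simp [h2, Nat.even_iff.mp (Nat.not_odd_iff_even.mp h2)]
  -- When degrees move, only the existence of some scalar is needed. `iterList_perm` compares two
  -- families, and here both are `y`.
  · let l : Fin (m + 1) → ℕ × Total H (power X (m + 1)) × Total H (power X (m + 1)) :=
      fun j => (d (g.symm j), y j, y j)
    obtain ⟨e, he, -⟩ := iterList_perm (c.total (power X (m + 1)))
      (fun r z => ∃ b, z =
        DirectSum.lof k ℕ (fun n => (H.obj (op (power X (m + 1))) n : Type w)) r b)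
      (by
        rintro i j _ _ ⟨y, rfl⟩ ⟨z, rfl⟩
        rw [c.total_lof, c.total_lof, c.graded_comm])
      (total_assoc c _) (Equiv.Perm.ofFn_comp_perm g l)
      (by
        intro p hp
        rw [List.mem_ofFn] at hp
        obtain ⟨i, rfl⟩ := hp
        exact ⟨hy _, hy _⟩)
    rw [List.map_ofFn, List.map_ofFn, ← iter_eq_iterList, ← iter_eq_iterList] at he
    exact ⟨e, he, fun h => absurd h hd⟩

variable {η : ℕ → Type*}

/-- The basis of `H^•(X^{m+1})` formed by the exterior products of the elements of a homogeneous
basis of `H^•(X)`. -/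
def powerBasis (c : CupProduct H) (hK : c.Kunneth) {X : C}
    (b : ∀ i, Module.Basis (η i) k (H.obj (op X) i)) (m : ℕ) :
    Module.Basis (Fin (m + 1) → Σ i, η i) k (Total H (power X (m + 1))) :=
  (Basis.piTensorProduct fun _ => gradedBasis b).map
    (LinearEquiv.ofBijective _ (kunnethPower_bijective c hK X m))

theorem powerBasis_apply (c : CupProduct H) (hK : c.Kunneth) {X : C}
    (b : ∀ i, Module.Basis (η i) k (H.obj (op X) i)) (m : ℕ) (f : Fin (m + 1) → Σ i, η i) :
    powerBasis c hK b m f = iter (c.total (power X (m + 1))) m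
      fun i => pull H (proj X (m + 1) i) (gradedBasis b (f i)) := by
  rw [powerBasis, Module.Basis.map_apply, Basis.piTensorProduct_apply,
    LinearEquiv.ofBijective_apply, kunnethPower_tprod]

theorem powerBasis_repr_iter (c : CupProduct H) (hK : c.Kunneth) {X : C}
    (b : ∀ i, Module.Basis (η i) k (H.obj (op X) i)) (m : ℕ) (a : Fin (m + 1) → Total H X)
    (f : Fin (m + 1) → Σ i, η i) :
    (powerBasis c hK b m).repr (iter (c.total (power X (m + 1))) m
      fun i => pull H (proj X (m + 1) i) (a i)) f = ∏ i, (gradedBasis b).repr (a i) (f i) := by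
  rw [← kunnethPower_tprod, powerBasis, Module.Basis.map_repr, LinearEquiv.trans_apply,
    ← Basis.piTensorProduct_repr_tprod_apply]
  congr 1
  congr 1
  exact (LinearEquiv.ofBijective _ (kunnethPower_bijective c hK X m)).symm_apply_apply _

theorem powerBasis_homogeneous (c : CupProduct H) (hK : c.Kunneth) {X : C}
    (b : ∀ i, Module.Basis (η i) k (H.obj (op X) i)) (m : ℕ) (f : Fin (m + 1) → Σ i, η i) :
    ∃ z, powerBasis c hK b m f = DirectSum.lof k ℕ
      (fun n => (H.obj (op (power X (m + 1))) n : Type w)) (∑ i, (f i).1) z := by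
  rw [powerBasis_apply]
  simp only [gradedBasis_apply, pull_lof]
  exact iter_homogeneous c _ m _ _

/-- The diagonal matrix entries of `φ_{X^{m+1}} ∘ g^*`. -/
theorem powerBasis_repr_powerEnd_pull (c : CupProduct H) (hK : c.Kunneth) {X : C}
    (φ : ∀ i, Module.End k (H.obj (op X) i))
    (b : ∀ i, Module.Basis (η i) k (H.obj (op X) i)) (m : ℕ) (g : Equiv.Perm (Fin (m + 1)))
    (f : Fin (m + 1) → Σ i, η i) :
    (powerBasis c hK b m).repr (powerEnd c hK φ (m + 1)
        (pull H (permMap X (m + 1) g) (powerBasis c hK b m f))) f =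
      restrictSign (oddPositions (fun l : Σ i, η i => Odd l.1) f) g *
        ∏ i, gradedMatrix b φ (f (g i)) (f i) := by
  obtain ⟨e, he, he'⟩ := pull_permMap_iter c X m g (fun i => (f i).1)
    (fun i => gradedBasis b (f i)) (fun i => ⟨_, gradedBasis_apply b (f i)⟩)
  rw [powerBasis_apply, he, map_smul, map_smul, powerEnd_iter, Finsupp.smul_apply,
    powerBasis_repr_iter, smul_eq_mul]
  have h1 : ∏ i, (gradedBasis b).repr (DirectSum.lmap φ (gradedBasis b (f (g.symm i)))) (f i) =
      ∏ i, gradedMatrix b φ (f (g i)) (f i) := by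
    rw [← Equiv.prod_comp g]
    simp [gradedMatrix]
  rw [h1]
  by_cases hd : ∀ i, (f (g i)).1 = (f i).1
  · rw [he' hd]
    rfl
  -- The unknown scalar is harmless: some factor is a matrix entry between different degrees, hence
  -- zero.
  · push Not at hd
    obtain ⟨i, hi⟩ := hd
    rw [Finset.prod_eq_zero (Finset.mem_univ i) (gradedMatrix_of_ne b φ hi), mul_zero, mul_zero]

end PowerTrace

/-! ### The cohomology of a terminal object. -/

section Terminal

variable {C : Type u} [Category.{v} C] {k : Type x} [Field k]
  {H : Cᵒᵖ ⥤ GradedObject ℕ (ModuleCat.{w} k)} [HasFiniteProducts C]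

/-- If `H^•(P) = 0`, Künneth gives `H^•(Y × P) = 0`; but `Y × P ≅ Y`, so all cohomology would
vanish. -/
theorem nontrivial_total_of_isTerminal (c : CupProduct H) (hK : c.Kunneth)
    (hne : ∃ (Y : C) (i : ℕ), Nontrivial (H.obj (op Y) i)) {P : C} (hP : IsTerminal P) :
    Nontrivial (Total H P) := by
  by_contra hsub
  rw [not_nontrivial_iff_subsingleton] at hsub
  obtain ⟨Y, i, hY⟩ := hne
  have h1 : Subsingleton (Total H Y ⊗[k] Total H P) := by
    refine ⟨fun a b => ?_⟩
    have h0 : ∀ a : Total H Y ⊗[k] Total H P, a = 0 := fun a => by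
      induction a with
      | zero => rfl
      | tmul y z => rw [Subsingleton.elim z 0, TensorProduct.tmul_zero]
      | add _ _ h h' => rw [h, h', add_zero]
    rw [h0 a, h0 b]
  have h2 : Subsingleton (Total H (Y ⨯ P)) := (hK Y P).2.subsingleton
  have h3 : IsIso (prod.fst : Y ⨯ P ⟶ Y) :=
    ⟨prod.lift (𝟙 Y) (hP.from Y), by
      apply Limits.prod.hom_ext
      · rw [Category.assoc, prod.lift_fst, Category.comp_id, Category.id_comp]
      · exact hP.hom_ext _ _, prod.lift_fst _ _⟩
  have h4 : Subsingleton (Total H Y) := (pull_bijective (H := H) (prod.fst : Y ⨯ P ⟶ Y)).1.subsingleton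
  obtain ⟨y, hy⟩ := exists_ne (0 : H.obj (op Y) i)
  exact hy (DirectSum.of_injective (β := fun j => (H.obj (op Y) j : Type w)) i
    (Subsingleton.elim _ _))

/-- Over a terminal object all homogeneous classes are proportional. -/
theorem exists_smul_of_isTerminal (c : CupProduct H) (hK : c.Kunneth) {P : C} (hP : IsTerminal P)
    (i j : ℕ) (a : H.obj (op P) i) (b : H.obj (op P) j) (ha : a ≠ 0) :
    ∃ r : k, DirectSum.lof k ℕ (fun n => (H.obj (op P) n : Type w)) j b =
      r • DirectSum.lof k ℕ (fun n => (H.obj (op P) n : Type w)) i a := by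
  set a' := DirectSum.lof k ℕ (fun n => (H.obj (op P) n : Type w)) i a with ha'
  set b' := DirectSum.lof k ℕ (fun n => (H.obj (op P) n : Type w)) j b with hb'
  -- The two projections coincide, so graded commutativity and injectivity of the Künneth map give
  -- `a' ⊗ b' = ± b' ⊗ a'`. Contracting with a functional nonzero on `a'` makes `b'` a multiple of
  -- `a'`.
  have h1 : (prod.fst : P ⨯ P ⟶ P) = prod.snd := hP.hom_ext _ _
  have h2 : a' ⊗ₜ[k] b' = (-1 : k) ^ (i * j) • (b' ⊗ₜ[k] a') := by
    apply (hK P P).1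
    rw [map_smul]
    simp only [CupProduct.kunneth, TensorProduct.lift.tmul, LinearMap.compl₁₂_apply, h1]
    rw [ha', hb', pull_lof, pull_lof, c.total_lof, c.total_lof, c.graded_comm]
  have ha0 : a' ≠ 0 := fun h => ha
    (DirectSum.of_injective (β := fun n => (H.obj (op P) n : Type w)) i (h.trans (map_zero _).symm))
  obtain ⟨ℓ, hℓ⟩ := Module.Projective.exists_dual_ne_zero k ha0
  have h3 := congrArg (TensorProduct.lid k _ ∘ ℓ.rTensor (Total H P)) h2
  simp only [Function.comp_apply, map_smul, LinearMap.rTensor_tmul, TensorProduct.lid_tmul] at h3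
  refine ⟨(ℓ a')⁻¹ * ((-1) ^ (i * j) * ℓ b'), ?_⟩
  rw [mul_smul, mul_smul, ← h3, smul_smul, inv_mul_cancel₀ hℓ, one_smul]

/-- The cohomology of a terminal object is the base field, in degree `0`. -/
theorem finrank_of_isTerminal (c : CupProduct H) (hK : c.Kunneth)
    (hne : ∃ (Y : C) (i : ℕ), Nontrivial (H.obj (op Y) i)) {P : C} (hP : IsTerminal P) (m : ℕ) :
    Module.finrank k (H.obj (op P) m) = if m = 0 then 1 else 0 := by
  have hnt := nontrivial_total_of_isTerminal c hK hne hP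
  obtain ⟨y, hy⟩ := exists_ne (0 : Total H P)
  obtain ⟨r, hr⟩ : ∃ r, y r ≠ 0 := by
    by_contra! h
    exact hy (DFinsupp.ext h)
  -- If `r > 0`, the square of `y r` lies in degree `2r ≠ r` and is proportional to `y r`, hence
  -- zero. Since the projections of `P ⨯ P` agree, the Künneth image of `e ⊗ e` is the pullback of
  -- that square, so `e ⊗ e = 0`, which is impossible for `e ≠ 0`.
  have hr0 : r = 0 := by
    by_contra hr0
    have h1 : (prod.fst : P ⨯ P ⟶ P) = prod.snd := hP.hom_ext _ _
    obtain ⟨q, hq⟩ := exists_smul_of_isTerminal c hK hP r (r + r) (y r) (c.cup P r r (y r) (y r)) hr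
    have h2 := congrArg (DirectSum.component k ℕ (fun n => (H.obj (op P) n : Type w)) r) hq
    rw [map_smul, DirectSum.component.lof_self, DirectSum.component.of, dif_neg (by omega)] at h2
    have hq0 : q = 0 := (smul_eq_zero.mp h2.symm).resolve_right hr
    rw [hq0, zero_smul, ← c.total_lof] at hq
    set e := DirectSum.lof k ℕ (fun n => (H.obj (op P) n : Type w)) r (y r) with he
    have he0 : e ≠ 0 := fun h => hr
      (DirectSum.of_injective (β := fun n => (H.obj (op P) n : Type w)) r
        (h.trans (map_zero _).symm))
    have h3 : e ⊗ₜ[k] e = 0 := by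
      apply (hK P P).1
      simp only [CupProduct.kunneth, TensorProduct.lift.tmul, LinearMap.compl₁₂_apply, h1]
      rw [← pull_total, hq, map_zero, map_zero]
    obtain ⟨ℓ, hℓ⟩ := Module.Projective.exists_dual_ne_zero k he0
    have h4 := congrArg (TensorProduct.lid k _ ∘ ℓ.rTensor (Total H P)) h3
    simp only [Function.comp_apply, LinearMap.rTensor_tmul, TensorProduct.lid_tmul, map_zero] at h4
    exact (smul_eq_zero.mp h4).elim hℓ he0
  subst hr0
  split_ifs with hm
  · subst hm
    refine finrank_eq_one (y 0) hr fun z => ?_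
    obtain ⟨q, hq⟩ := exists_smul_of_isTerminal c hK hP 0 0 (y 0) z hr
    refine ⟨q, ?_⟩
    rw [← map_smul] at hq
    exact (DirectSum.of_injective (β := fun n => (H.obj (op P) n : Type w)) 0 hq).symm
  · have : Subsingleton (H.obj (op P) m) := by
      refine subsingleton_of_forall_eq 0 fun z => ?_
      obtain ⟨q, hq⟩ := exists_smul_of_isTerminal c hK hP 0 m (y 0) z hr
      have h2 := congrArg (DirectSum.component k ℕ (fun n => (H.obj (op P) n : Type w)) m) hq
      rw [map_smul, DirectSum.component.lof_self, DirectSum.component.of,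
        dif_neg (fun h => hm h.symm), smul_zero] at h2
      exact h2
    exact Module.finrank_zero_of_subsingleton

end Terminal

/-! ### The truncated matrix of `⨁ uⁱφᵢ` and its supertrace. -/

section WeightedMatrix

/-- The inclusion of the indices of degree at most `N`. -/
def truncIncl (η : ℕ → Type*) (N : ℕ) (l : Σ i : Fin (N + 1), η i) : Σ i, η i := ⟨l.1, l.2⟩

theorem truncIncl_injective {η : ℕ → Type*} (N : ℕ) : Function.Injective (truncIncl η N) := by
  rintro ⟨⟨i, hi⟩, y⟩ ⟨⟨j, hj⟩, z⟩ h
  simp only [truncIncl, Sigma.mk.injEq] at h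
  obtain ⟨rfl, h⟩ := h
  rw [eq_of_heq h]

variable {k : Type*} [Field k] {V : ℕ → Type*} [∀ i, AddCommGroup (V i)] [∀ i, Module k (V i)]
  {η : ℕ → Type*} [∀ i, Fintype (η i)] [∀ i, DecidableEq (η i)]

/-- The matrix of `uⁱ ψ` over `k⟦u⟧`. -/
def weightedBlock (b : ∀ i, Module.Basis (η i) k (V i)) (φ : ∀ i, Module.End k (V i)) (i : ℕ) :
    Matrix (η i) (η i) (PowerSeries k) :=
  (PowerSeries.X : PowerSeries k) ^ i • (LinearMap.toMatrix (b i) (b i) (φ i)).map PowerSeries.C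

/-- The block diagonal matrix of `⨁ uⁱ φᵢ`, for `i ≤ N`. -/
def weightedMatrix (b : ∀ i, Module.Basis (η i) k (V i)) (φ : ∀ i, Module.End k (V i)) (N : ℕ) :
    Matrix (Σ i : Fin (N + 1), η i) (Σ i : Fin (N + 1), η i) (PowerSeries k) :=
  Matrix.blockDiagonal' fun i => weightedBlock b φ i

theorem weightedMatrix_apply (b : ∀ i, Module.Basis (η i) k (V i)) (φ : ∀ i, Module.End k (V i))
    (N : ℕ) (l l' : Σ i : Fin (N + 1), η i) :
    weightedMatrix b φ N l l' = PowerSeries.X ^ (l'.1 : ℕ) *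
      PowerSeries.C (gradedMatrix b φ (truncIncl η N l) (truncIncl η N l')) := by
  obtain ⟨i, y⟩ := l
  obtain ⟨j, z⟩ := l'
  by_cases h : i = j
  · subst h
    rw [weightedMatrix, Matrix.blockDiagonal'_apply_eq, weightedBlock, Matrix.smul_apply,
      Matrix.map_apply, LinearMap.toMatrix_apply, smul_eq_mul]
    simp only [truncIncl, gradedMatrix_same]
  · rw [weightedMatrix, Matrix.blockDiagonal'_apply_ne _ _ _ h, gradedMatrix_of_ne, map_zero,
      mul_zero]
    exact fun hh => h (Fin.ext hh)

/-- The parity of an index. -/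
abbrev oddIndex (η : ℕ → Type*) (N : ℕ) (l : Σ i : Fin (N + 1), η i) : Prop := Odd (l.1 : ℕ)

/-- A word of total degree `m` carries the weight `u^m`, and its number of odd letters has the
parity of `m`. Thus the supertrace sign is exactly the sign in `(-u)^m`. -/
theorem coeff_superTrace (b : ∀ i, Module.Basis (η i) k (V i)) (φ : ∀ i, Module.End k (V i))
    (N n m : ℕ) (g : Equiv.Perm (Fin n)) :
    PowerSeries.coeff m (superTrace (oddIndex η N) (weightedMatrix b φ N) g) =
      (-1) ^ m * ∑ f : {f : Fin n → Σ i : Fin (N + 1), η i // ∑ i, ((f i).1 : ℕ) = m},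
        (restrictSign (oddPositions (oddIndex η N) f.1) g *
          ∏ i, gradedMatrix b φ (truncIncl η N (f.1 (g i))) (truncIncl η N (f.1 i))) := by
  rw [superTrace, map_sum, ← Finset.sum_subtype
    (Finset.univ.filter fun f : Fin n → Σ i : Fin (N + 1), η i => ∑ i, ((f i).1 : ℕ) = m) (by simp)
    (fun f => (restrictSign (oddPositions (oddIndex η N) f) g : k) *
      ∏ i, gradedMatrix b φ (truncIncl η N (f (g i))) (truncIncl η N (f i))),
    Finset.sum_filter, Finset.mul_sum]
  refine Finset.sum_congr rfl fun f _ => ?_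
  have h1 : (-1 : PowerSeries k) ^ (oddPositions (oddIndex η N) f).card *
      ((restrictSign (oddPositions (oddIndex η N) f) g : PowerSeries k) *
        ∏ i, weightedMatrix b φ N (f (g i)) (f i)) =
      PowerSeries.X ^ (∑ i, ((f i).1 : ℕ)) *
        PowerSeries.C ((-1) ^ (oddPositions (oddIndex η N) f).card *
          ((restrictSign (oddPositions (oddIndex η N) f) g : k) *
            ∏ i, gradedMatrix b φ (truncIncl η N (f (g i))) (truncIncl η N (f i)))) := by
    simp only [weightedMatrix_apply, Finset.prod_mul_distrib, Finset.prod_pow_eq_pow_sum, map_mul,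
      map_pow, map_neg, map_one, map_intCast, map_prod]
    ring
  have h2 : (-1 : k) ^ (oddPositions (oddIndex η N) f).card = (-1) ^ ∑ i, ((f i).1 : ℕ) := by
    rw [← Finset.prod_pow_eq_pow_sum, oddPositions, ← Finset.prod_const, Finset.prod_filter]
    refine Finset.prod_congr rfl fun i _ => ?_
    split_ifs with h
    · exact h.neg_one_pow.symm
    · exact (Nat.not_odd_iff_even.mp h).neg_one_pow.symm
  rw [h1, PowerSeries.coeff_mul_C, PowerSeries.coeff_X_pow, h2]
  by_cases h : ∑ i, ((f i).1 : ℕ) = m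
  · rw [if_pos h.symm, if_pos h, one_mul, h]
  · rw [if_neg (Ne.symm h), if_neg h, zero_mul, mul_zero]

end WeightedMatrix

/-! ### Lefschetz series of invariants as averages of supertraces. -/

section Trace

variable {C : Type u} [Category.{v} C] {k : Type x} [Field k]
  {H : Cᵒᵖ ⥤ GradedObject ℕ (ModuleCat.{w} k)} [HasFiniteProducts C]
  {η : ℕ → Type*} [∀ i, Fintype (η i)] [∀ i, DecidableEq (η i)]

/-- The traces of `φ_{Xⁿ} ∘ g^*` are the coefficients of the supertrace. -/
theorem trace_powerEndDeg_comp_pullDeg (c : CupProduct H) (hK : c.Kunneth)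
    (hne : ∃ (Y : C) (i : ℕ), Nontrivial (H.obj (op Y) i))
    (hfin : ∀ (Y : C) (i : ℕ), FiniteDimensional k (H.obj (op Y) i)) {X : C}
    (φ : ∀ i, Module.End k (H.obj (op X) i))
    (b : ∀ i, Module.Basis (η i) k (H.obj (op X) i)) (n m N : ℕ) (hm : m ≤ N)
    (g : Equiv.Perm (Fin n)) :
    (-1) ^ m * LinearMap.trace k _ (powerEndDeg c hK φ n m ∘ₗ pullDeg H (permMap X n g) m) =
      PowerSeries.coeff m (superTrace (oddIndex η N) (weightedMatrix b φ N) g) := by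
  cases n with
  | zero =>
    -- For `n = 0` the endomorphism is the identity, so the trace is the dimension of the cohomology
    -- of a terminal object.
    have hP : IsTerminal (power X 0) :=
      IsTerminal.ofUniqueHom (fun Y => Pi.lift fun i => i.elim0)
        (fun Y f => by apply Pi.hom_ext; intro i; exact i.elim0)
    have h1 : permMap X 0 g = 𝟙 _ := hP.hom_ext _ _
    have h2 : powerEndDeg c hK φ 0 m ∘ₗ pullDeg H (permMap X 0 g) m = LinearMap.id := by
      rw [h1]
      ext a
      simp only [powerEndDeg, powerEnd, LinearMap.comp_apply, LinearMap.id_apply]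
      rw [DirectSum.component.lof_self]
      simp [pullDeg]
    have := hfin (power X 0) m
    rw [h2, LinearMap.trace_id, finrank_of_isTerminal c hK hne hP]
    have h3 : superTrace (oddIndex η N) (weightedMatrix b φ N) g = 1 := by
      rw [Subsingleton.elim g 1]
      simp [superTrace, Finset.eq_empty_of_isEmpty, restrictSign_one]
    rw [h3, PowerSeries.coeff_one]
    split_ifs with h
    · simp [h]
    · simp
  | succ n =>
    rw [coeff_superTrace]
    congr 1
    rw [trace_eq_sum_repr (powerBasis c hK b n) (fun f => ∑ i, (f i).1)
      (powerBasis_homogeneous c hK b n) m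
      (powerEnd c hK φ (n + 1) ∘ₗ pull H (permMap X (n + 1) g)) _ ?_
      (fun (f : Fin (n + 1) → Σ i : Fin (N + 1), η i) i => truncIncl η N (f i)) ?_ ?_]
    · refine Finset.sum_congr rfl fun f _ => ?_
      exact powerBasis_repr_powerEnd_pull c hK φ b n g _
    · intro y
      rw [LinearMap.comp_apply, pull_lof, powerEnd_lof]
      rfl
    · intro f f' h
      ext1 i
      exact truncIncl_injective N (congrFun h i)
    · intro f hf
      -- Every letter of a word of total degree `m ≤ N` has degree at most `N`, so the truncation
      -- loses no word.
      have hle : ∀ i, (f i).1 < N + 1 := fun i => by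
        have := Finset.single_le_sum (f := fun i => (f i).1) (fun _ _ => Nat.zero_le _)
          (Finset.mem_univ i)
        simp only [hf] at this
        omega
      exact ⟨fun i => ⟨⟨(f i).1, hle i⟩, (f i).2⟩, rfl⟩

theorem card_mul_coeff_lefschetz [CharZero k] (c : CupProduct H) (hK : c.Kunneth)
    (hne : ∃ (Y : C) (i : ℕ), Nontrivial (H.obj (op Y) i))
    (hfin : ∀ (Y : C) (i : ℕ), FiniteDimensional k (H.obj (op Y) i)) {X : C}
    (φ : ∀ i, Module.End k (H.obj (op X) i))
    (b : ∀ i, Module.Basis (η i) k (H.obj (op X) i)) (n m N : ℕ) (hm : m ≤ N)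
    (G : Subgroup (Equiv.Perm (Fin n))) [Fintype G] :
    (Fintype.card G : k) * PowerSeries.coeff m (lefschetz (invariantEnd c hK φ G)) =
      ∑ g : G, PowerSeries.coeff m
        (superTrace (oddIndex η N) (weightedMatrix b φ N) (g : Equiv.Perm (Fin n))) := by
  have := hfin (power X n) m
  have h := card_mul_trace_restrict_invariants G (fun g => pullDeg H (permMap X n g) m)
    (pullDeg_permMap_mul X n m) (invariants H X G m) (fun _ => Iff.rfl) (powerEndDeg c hK φ n m)
    (powerEndDeg_mem_invariants c hK φ G m)
  rw [lefschetz, PowerSeries.coeff_mk, mul_left_comm, invariantEnd, h, Finset.mul_sum]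
  exact Finset.sum_congr rfl fun g _ => trace_powerEndDeg_comp_pullDeg c hK hne hfin φ b n m N hm g

end Trace

/-! ### Reduction modulo powers of `u`. -/

section EqUpTo

variable {k : Type*} [Field k]

/-- Reduction of the coefficients of a series in `k⟦u⟧⟦t⟧` modulo `u^N`. -/
def reduceMod (k : Type*) [Field k] (N : ℕ) : PowerSeries (PowerSeries k) →+*
    PowerSeries (PowerSeries k ⧸ Ideal.span {(PowerSeries.X : PowerSeries k) ^ N}) :=
  PowerSeries.map (Ideal.Quotient.mk _)

theorem reduceMod_eq_iff (N : ℕ) (F G : PowerSeries (PowerSeries k)) :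
    reduceMod k N F = reduceMod k N G ↔ ∀ n, ∀ m < N,
      PowerSeries.coeff m (PowerSeries.coeff n F) = PowerSeries.coeff m (PowerSeries.coeff n G) := by
  rw [PowerSeries.ext_iff]
  refine forall_congr' fun n => ?_
  rw [reduceMod, PowerSeries.coeff_map, PowerSeries.coeff_map, Ideal.Quotient.eq,
    Ideal.mem_span_singleton, PowerSeries.X_pow_dvd_iff]
  simp only [map_sub, sub_eq_zero]

/-- The coefficient of `u^m` is already determined at `N = max d m`. The lower bound `d` allows
product formulas that hold only once the truncation contains all of `H^•(X)`. -/
theorem eq_of_forall_reduceMod (d : ℕ) (F G : PowerSeries (PowerSeries k))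
    (h : ∀ N, d ≤ N → reduceMod k (N + 1) F = reduceMod k (N + 1) G) : F = G := by
  ext n m
  exact (reduceMod_eq_iff _ F G).mp (h (max d m) (le_max_left _ _)) n m
    (Nat.lt_succ_of_le (le_max_right _ _))

theorem map_evalNegHom {R S : Type*} [CommRing R] [CommRing S] (f : R →+* S) (F : PowerSeries R) :
    PowerSeries.map f (PowerSeries.evalNegHom F) = PowerSeries.evalNegHom (PowerSeries.map f F) := by
  ext n
  simp [PowerSeries.evalNegHom]

theorem evalNegHom_evalNegHom {R : Type*} [CommRing R] (F : PowerSeries R) :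
    PowerSeries.evalNegHom (PowerSeries.evalNegHom F) = F := by
  ext n
  simp [PowerSeries.evalNegHom, ← mul_assoc, ← mul_pow]

theorem reduceMod_evalNegHom (N : ℕ) (F : PowerSeries (PowerSeries k)) :
    reduceMod k N (PowerSeries.evalNegHom F) = PowerSeries.evalNegHom (reduceMod k N F) :=
  map_evalNegHom _ F

end EqUpTo

/-! ### Consequences of MacMahon's theorem for super series. -/

section SuperSeries

variable {k : Type*} [Field k] [CharZero k] {R B : Type*} [CommRing R] [Algebra k R] [Fintype B]

/-- The product is `P_odd(-t) D_even(t) · D_odd(t) P_even(-t)`. MacMahon's theorem with `t` replaced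
by `-t` cancels the odd pair and the even pair. -/
theorem superSeries_mul (p : B → Prop) [DecidablePred p] (M : Matrix B B R) :
    expSeries k (fun n => ∑ g : Equiv.Perm (Fin n), ((g.sign : ℤ) : R) * superTrace p M g) *
      PowerSeries.evalNegHom
        (expSeries k (fun n => ∑ g : Equiv.Perm (Fin n), superTrace p M g)) = 1 := by
  rw [expSeries_sum_superTrace, expSeries_sum_sign_mul_superTrace, map_mul, evalNegHom_evalNegHom]
  have h1 := congrArg PowerSeries.evalNegHom (evalNegHom_detSum_mul_permSum k (matrixPart p M))
  have h2 := congrArg PowerSeries.evalNegHom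
    (evalNegHom_detSum_mul_permSum k (matrixPart (fun b => ¬ p b) M))
  rw [map_mul, evalNegHom_evalNegHom, map_one] at h1 h2
  linear_combination (expSeries k (detSum (matrixPart (fun b => ¬ p b) M)) *
    PowerSeries.evalNegHom (expSeries k (permSum (matrixPart (fun b => ¬ p b) M)))) * h1 + h2

theorem superSeries_mul_det (p : B → Prop) [DecidablePred p] (M : Matrix B B R) :
    expSeries k (fun n => ∑ g : Equiv.Perm (Fin n), superTrace p M g) *
      PowerSeries.evalNegHom (expSeries k (detSum (matrixPart (fun b => ¬ p b) M))) =
    PowerSeries.evalNegHom (expSeries k (detSum (matrixPart p M))) := by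
  rw [expSeries_sum_superTrace]
  linear_combination PowerSeries.evalNegHom (expSeries k (detSum (matrixPart p M))) *
    evalNegHom_detSum_mul_permSum k (matrixPart (fun b => ¬ p b) M)

end SuperSeries

/-! ### Determinants of block diagonal matrices. -/

section BlockDiagonal

theorem det_blockDiagonal' {R : Type*} [CommRing R] {o : Type*} [Fintype o] [LinearOrder o]
    {η : o → Type*} [∀ i, Fintype (η i)] [∀ i, DecidableEq (η i)]
    (M : ∀ i, Matrix (η i) (η i) R) : (Matrix.blockDiagonal' M).det = ∏ i, (M i).det := by
  have h : (Matrix.blockDiagonal' M).BlockTriangular Sigma.fst := by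
    rintro ⟨i, y⟩ ⟨j, z⟩ hij
    exact Matrix.blockDiagonal'_apply_ne _ _ _ (ne_of_gt hij)
  rw [h.det_fintype]
  refine Finset.prod_congr rfl fun i _ => ?_
  let e : η i ≃ {l : Σ i, η i // l.1 = i} :=
    { toFun := fun y => ⟨⟨i, y⟩, rfl⟩
      invFun := fun l => l.2 ▸ l.1.2
      left_inv := fun y => rfl
      right_inv := by rintro ⟨⟨j, y⟩, rfl⟩; rfl }
  rw [← Matrix.det_submatrix_equiv_self e]
  congr 1
  ext y z
  exact Matrix.blockDiagonal'_apply_eq _ _ _ _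

variable {k : Type*} [Field k] {V : ℕ → Type*} [∀ i, AddCommGroup (V i)]
  [∀ i, Module k (V i)] {η : ℕ → Type*} [∀ i, Fintype (η i)] [∀ i, DecidableEq (η i)]

/-- The series `det(1 + uⁱ t φᵢ)`. -/
def blockSeries (b : ∀ i, Module.Basis (η i) k (V i)) (φ : ∀ i, Module.End k (V i)) (i : ℕ) :
    PowerSeries (PowerSeries k) := expSeries k (detSum (weightedBlock b φ i))

theorem isUnit_blockSeries (b : ∀ i, Module.Basis (η i) k (V i)) (φ : ∀ i, Module.End k (V i))
    (i : ℕ) : IsUnit (blockSeries b φ i) := by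
  rw [PowerSeries.isUnit_iff_constantCoeff, ← PowerSeries.coeff_zero_eq_constantCoeff_apply,
    blockSeries, expSeries, PowerSeries.coeff_mk]
  simp [detSum]

variable [CharZero k]

/-- Deleting the blocks where `q` fails leaves identity blocks in `1 + tM`, which contribute the
factors `1`. -/
theorem expSeries_detSum_matrixPart (b : ∀ i, Module.Basis (η i) k (V i))
    (φ : ∀ i, Module.End k (V i)) (N : ℕ) (q : ℕ → Prop) [DecidablePred q] :
    expSeries k (detSum (matrixPart (fun l : Σ i : Fin (N + 1), η i => q l.1)
      (weightedMatrix b φ N))) =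
      ∏ i ∈ Finset.range (N + 1), if q i then blockSeries b φ i else 1 := by
  rw [expSeries_detSum, ← Fin.prod_univ_eq_prod_range (fun i => if q i then blockSeries b φ i else 1)]
  have h : (1 + (PowerSeries.X : PowerSeries (PowerSeries k)) •
      (matrixPart (fun l : Σ i : Fin (N + 1), η i => q l.1) (weightedMatrix b φ N)).map
        PowerSeries.C) =
      Matrix.blockDiagonal' fun i : Fin (N + 1) => if q i then
        1 + (PowerSeries.X : PowerSeries (PowerSeries k)) • (weightedBlock b φ i).map PowerSeries.C
        else 1 := by
    ext1 ⟨i, y⟩ ⟨j, z⟩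
    by_cases hij : i = j
    · subst hij
      rw [Matrix.blockDiagonal'_apply_eq]
      split_ifs with hq
      · simp [matrixPart, hq, weightedMatrix, Matrix.blockDiagonal'_apply_eq, Matrix.one_apply]
      · simp [matrixPart, hq, Matrix.one_apply]
    · rw [Matrix.blockDiagonal'_apply_ne _ _ _ hij]
      simp [matrixPart, weightedMatrix, Matrix.blockDiagonal'_apply_ne _ _ _ hij, hij]
  rw [h, det_blockDiagonal']
  refine Finset.prod_congr rfl fun i _ => ?_
  split_ifs
  · rw [blockSeries, expSeries_detSum]
  · exact Matrix.det_one

theorem blockSeries_eq_one (b : ∀ i, Module.Basis (η i) k (V i)) (φ : ∀ i, Module.End k (V i))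
    (i : ℕ) [Subsingleton (V i)] : blockSeries b φ i = 1 := by
  have : IsEmpty (η i) := ⟨fun y => (b i).ne_zero y (Subsingleton.elim _ _)⟩
  rw [blockSeries, expSeries_detSum, Matrix.det_isEmpty]

end BlockDiagonal

/-! ### Base-changed determinants in a basis. -/

section DetOneAdd

variable {k : Type x} [Field k] {V : Type w} [AddCommGroup V] [Module k V] {η : Type*} [Fintype η]
  [DecidableEq η]

theorem detOneAdd_eq_det {R : Type x} [CommRing R] [Algebra k R] (b : Module.Basis η k V) (z : R)
    (f : Module.End k V) :
    detOneAdd z f = (1 + z • (LinearMap.toMatrix b b f).map (algebraMap k R)).det := by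
  rw [detOneAdd, ← LinearMap.det_toMatrix (Algebra.TensorProduct.basis R b), map_add, map_smul,
    LinearMap.toMatrix_id, LinearMap.toMatrix_baseChange]

end DetOneAdd

/-! ### The symmetric and alternating generating series. -/

section GeneratingSeries

variable {C : Type u} [Category.{v} C] {k : Type x} [Field k]
  {H : Cᵒᵖ ⥤ GradedObject ℕ (ModuleCat.{w} k)} [HasFiniteProducts C]
  {η : ℕ → Type*} [∀ i, Fintype (η i)] [∀ i, DecidableEq (η i)]

theorem coeff_coeff_expSeries (F : ℕ → PowerSeries k) (n m : ℕ) :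
    PowerSeries.coeff m (PowerSeries.coeff n (expSeries k F)) =
      (n.factorial : k)⁻¹ * PowerSeries.coeff m (F n) := by
  rw [expSeries, PowerSeries.coeff_mk, ← PowerSeries.C_eq_algebraMap, PowerSeries.coeff_C_mul]

/-- This identifies the `t`-coefficient of the sign-twisted series with that of `L_u(φ) t`, up to
order `N` in `u`. -/
theorem superTrace_fin_one (V : ℕ → Type*) [∀ i, AddCommGroup (V i)] [∀ i, Module k (V i)]
    (b : ∀ i, Module.Basis (η i) k (V i))
    (φ : ∀ i, Module.End k (V i)) (N m : ℕ) (hm : m ≤ N) :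
    PowerSeries.coeff m (superTrace (oddIndex η N) (weightedMatrix b φ N)
      (1 : Equiv.Perm (Fin 1))) = (-1) ^ m * LinearMap.trace k (V m) (φ m) := by
  rw [coeff_superTrace, trace_eq_sum_repr (gradedBasis b) (fun l => l.1)
    (fun l => ⟨_, gradedBasis_apply b l⟩) m (DirectSum.lmap φ) (φ m)
    (fun y => DirectSum.lmap_lof _ _ _) (truncIncl η N) (truncIncl_injective N)
    (fun f hf => ⟨⟨⟨f.1, by omega⟩, f.2⟩, rfl⟩)]
  congr 1
  refine Fintype.sum_equiv ((Equiv.funUnique (Fin 1) _).subtypeEquiv fun f => ?_) _ _ fun f => ?_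
  · simp [truncIncl]
  · simp [restrictSign_one, gradedMatrix]

variable [CharZero k]

/-- The symmetric generating series agrees with a super power series up to order `N` in `u`. -/
theorem reduceMod_genSeries_top (c : CupProduct H) (hK : c.Kunneth)
    (hne : ∃ (Y : C) (i : ℕ), Nontrivial (H.obj (op Y) i))
    (hfin : ∀ (Y : C) (i : ℕ), FiniteDimensional k (H.obj (op Y) i)) {X : C}
    (φ : ∀ i, Module.End k (H.obj (op X) i))
    (b : ∀ i, Module.Basis (η i) k (H.obj (op X) i)) (N : ℕ) :
    reduceMod k (N + 1) (genSeries c hK φ fun _ => ⊤) =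
      reduceMod k (N + 1) (expSeries k fun n => ∑ g : Equiv.Perm (Fin n),
        superTrace (oddIndex η N) (weightedMatrix b φ N) g) := by
  classical
  rw [reduceMod_eq_iff]
  intro n m hm
  have hc : (n.factorial : k) ≠ 0 := by exact_mod_cast n.factorial_ne_zero
  have h := card_mul_coeff_lefschetz c hK hne hfin φ b n m N (Nat.lt_succ_iff.mp hm) ⊤
  have h1 : Fintype.card (⊤ : Subgroup (Equiv.Perm (Fin n))) = n.factorial := by
    rw [Fintype.card_congr Subgroup.topEquiv.toEquiv, Fintype.card_perm, Fintype.card_fin]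
  rw [h1] at h
  rw [coeff_coeff_expSeries, genSeries, PowerSeries.coeff_mk, eq_inv_mul_iff_mul_eq₀ hc, h, map_sum]
  exact Fintype.sum_equiv Subgroup.topEquiv.toEquiv _ _ fun g => rfl

theorem two_mul_card_alternatingGroup_fin {n : ℕ} (hn : 2 ≤ n) :
    2 * Fintype.card (alternatingGroup (Fin n)) = n.factorial := by
  have : Nontrivial (Fin n) := Fin.nontrivial_iff_two_le.mpr hn
  rw [two_mul_card_alternatingGroup, Fintype.card_perm, Fintype.card_fin]

/-- The indicator function of `Aₙ` is `(1 + sgn)/2`; this holds for every `n`, unlike `|Aₙ| = n!/2`.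
-/
theorem two_mul_sum_alternatingGroup {n : ℕ} {M : Type*} [CommRing M]
    (F : Equiv.Perm (Fin n) → M) :
    2 * ∑ g : alternatingGroup (Fin n), F g =
      ∑ g : Equiv.Perm (Fin n), F g + ∑ g : Equiv.Perm (Fin n), ((g.sign : ℤ) : M) * F g := by
  rw [← Finset.sum_add_distrib, ← Finset.sum_subtype (Finset.univ.filter fun g => g.sign = 1)
    (by simp [Equiv.Perm.mem_alternatingGroup]) F, Finset.sum_filter, Finset.mul_sum]
  refine Finset.sum_congr rfl fun g _ => ?_
  rcases Int.units_eq_one_or g.sign with h | h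
  · simp [h, two_mul]
  · simp [h]

/-- This identifies `A - S + 1 + L t` with the sign-twisted series `T` up to order `N`. The terms
`1` and `L t` matter only for `n = 0, 1`, where `Aₙ = Sₙ` and `A - S` has zero coefficient. -/
theorem reduceMod_alternating (c : CupProduct H) (hK : c.Kunneth)
    (hne : ∃ (Y : C) (i : ℕ), Nontrivial (H.obj (op Y) i))
    (hfin : ∀ (Y : C) (i : ℕ), FiniteDimensional k (H.obj (op Y) i)) {X : C}
    (φ : ∀ i, Module.End k (H.obj (op X) i))
    (b : ∀ i, Module.Basis (η i) k (H.obj (op X) i)) (N : ℕ) :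
    reduceMod k (N + 1) ((genSeries c hK φ fun n => alternatingGroup (Fin n)) -
      (genSeries c hK φ fun _ => ⊤) + 1 + PowerSeries.C (lefschetz φ) * PowerSeries.X) =
      reduceMod k (N + 1) (expSeries k fun n => ∑ g : Equiv.Perm (Fin n),
        ((g.sign : ℤ) : PowerSeries k) *
          superTrace (oddIndex η N) (weightedMatrix b φ N) g) := by
  rw [reduceMod_eq_iff]
  intro n m hm
  have hm' := Nat.lt_succ_iff.mp hm
  rw [coeff_coeff_expSeries]
  match n with
  | 0 =>
    have h1 : lefschetz (invariantEnd c hK φ (alternatingGroup (Fin 0))) =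
        lefschetz (invariantEnd c hK φ (⊤ : Subgroup (Equiv.Perm (Fin 0)))) := by
      rw [show alternatingGroup (Fin 0) = ⊤ by ext g; simp [Subsingleton.elim g 1]]
    simp [genSeries, h1, superTrace, restrictSign_one, Finset.eq_empty_of_isEmpty,
      PowerSeries.coeff_one, Finset.univ_unique, Subsingleton.elim (default : Equiv.Perm (Fin 0)) 1]
  | 1 =>
    have h1 : lefschetz (invariantEnd c hK φ (alternatingGroup (Fin 1))) =
        lefschetz (invariantEnd c hK φ (⊤ : Subgroup (Equiv.Perm (Fin 1)))) := by
      rw [show alternatingGroup (Fin 1) = ⊤ by ext g; simp [Subsingleton.elim g 1]]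
    simp only [genSeries, map_add, map_sub, PowerSeries.coeff_mk, h1, sub_self, zero_add,
      PowerSeries.coeff_one, one_ne_zero, if_false, PowerSeries.coeff_C_mul,
      PowerSeries.coeff_one_X, mul_one, Nat.factorial_one, Nat.cast_one, inv_one, one_mul,
      Finset.univ_unique, Finset.sum_singleton, Subsingleton.elim (default : Equiv.Perm (Fin 1)) 1,
      Equiv.Perm.sign_one, Units.val_one, Int.cast_one]
    rw [superTrace_fin_one _ b φ N m hm', lefschetz, PowerSeries.coeff_mk]
  | n + 2 =>
    have hc : ((n + 2).factorial : k) ≠ 0 := by exact_mod_cast (n + 2).factorial_ne_zero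
    have h2 := (reduceMod_eq_iff (N + 1) _ _).mp
      (reduceMod_genSeries_top c hK hne hfin φ b N) (n + 2) m hm
    rw [coeff_coeff_expSeries] at h2
    have h3 := card_mul_coeff_lefschetz c hK hne hfin φ b (n + 2) m N hm'
      (alternatingGroup (Fin (n + 2)))
    have h4 := congrArg (Nat.cast : ℕ → k)
      (two_mul_card_alternatingGroup_fin (show 2 ≤ n + 2 by omega))
    have h5 := two_mul_sum_alternatingGroup fun g : Equiv.Perm (Fin (n + 2)) =>
      PowerSeries.coeff m (superTrace (oddIndex η N) (weightedMatrix b φ N) g)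
    have h6 : ∀ g : Equiv.Perm (Fin (n + 2)), PowerSeries.coeff m (((g.sign : ℤ) : PowerSeries k) *
        superTrace (oddIndex η N) (weightedMatrix b φ N) g) = ((g.sign : ℤ) : k) *
        PowerSeries.coeff m (superTrace (oddIndex η N) (weightedMatrix b φ N) g) := fun g => by
      rw [← map_intCast (PowerSeries.C (R := k)), PowerSeries.coeff_C_mul]
    push_cast at h4
    have h7 : PowerSeries.coeff (n + 2) (1 + PowerSeries.C (lefschetz φ) * PowerSeries.X) = 0 := by
      rw [map_add, PowerSeries.coeff_one, PowerSeries.coeff_C_mul, PowerSeries.coeff_X]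
      simp
    rw [add_assoc, map_add, h7, add_zero, map_sub, map_sub, h2, genSeries, PowerSeries.coeff_mk,
      map_sum, map_sum, Finset.sum_congr rfl fun g _ => h6 g, eq_inv_mul_iff_mul_eq₀ hc, mul_sub,
      mul_inv_cancel_left₀ hc]
    linear_combination 2 * h3 + h5 - PowerSeries.coeff m (lefschetz (invariantEnd c hK φ
      (alternatingGroup (Fin (n + 2))))) * h4

/-- This is `T(t) S(-t) = 1`. Reduction modulo `u^{N+1}` is a ring homomorphism commuting with `t ↦
-t`, so `superSeries_mul` for the truncated matrices suffices. -/
theorem alternating_mul_evalNegHom (c : CupProduct H) (hK : c.Kunneth)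
    (hne : ∃ (Y : C) (i : ℕ), Nontrivial (H.obj (op Y) i))
    (hfin : ∀ (Y : C) (i : ℕ), FiniteDimensional k (H.obj (op Y) i)) {X : C}
    (φ : ∀ i, Module.End k (H.obj (op X) i))
    (b : ∀ i, Module.Basis (η i) k (H.obj (op X) i)) :
    ((genSeries c hK φ fun n => alternatingGroup (Fin n)) -
      (genSeries c hK φ fun _ => ⊤) + 1 + PowerSeries.C (lefschetz φ) * PowerSeries.X) *
      PowerSeries.evalNegHom (genSeries c hK φ fun _ => ⊤) = 1 := by
  refine eq_of_forall_reduceMod 0 _ _ fun N _ => ?_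
  rw [map_mul, reduceMod_alternating c hK hne hfin φ b N, reduceMod_evalNegHom,
    reduceMod_genSeries_top c hK hne hfin φ b N, ← reduceMod_evalNegHom, ← map_mul,
    superSeries_mul]

theorem prod_range_blockSeries_eq {V : ℕ → Type*} [∀ i, AddCommGroup (V i)] [∀ i, Module k (V i)]
    (b : ∀ i, Module.Basis (η i) k (V i)) (φ : ∀ i, Module.End k (V i)) {d N : ℕ} (hN : d ≤ N)
    (hd : ∀ i > d, Subsingleton (V i)) (q : ℕ → Prop) [DecidablePred q] :
    ∏ i ∈ Finset.range (N + 1), (if q i then blockSeries b φ i else 1) =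
      ∏ i ∈ Finset.range (d + 1), if q i then blockSeries b φ i else 1 := by
  symm
  refine Finset.prod_subset (Finset.range_mono (by omega)) fun i _ hi => ?_
  have := hd i (by simpa using hi)
  rw [blockSeries_eq_one, ite_self]

/-- This is `S(t) D_even(-t) = D_odd(-t)`. For `N ≥ d` the truncated products no longer depend on
`N`, as the extra blocks are empty. -/
theorem genSeries_top_mul_prod (c : CupProduct H) (hK : c.Kunneth)
    (hne : ∃ (Y : C) (i : ℕ), Nontrivial (H.obj (op Y) i))
    (hfin : ∀ (Y : C) (i : ℕ), FiniteDimensional k (H.obj (op Y) i)) {X : C}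
    (φ : ∀ i, Module.End k (H.obj (op X) i))
    (b : ∀ i, Module.Basis (η i) k (H.obj (op X) i)) (d : ℕ)
    (hd : ∀ i > d, Subsingleton (H.obj (op X) i)) :
    (genSeries c hK φ fun _ => ⊤) * PowerSeries.evalNegHom
      (∏ i ∈ Finset.range (d + 1), if ¬ Odd i then blockSeries b φ i else 1) =
      PowerSeries.evalNegHom
        (∏ i ∈ Finset.range (d + 1), if Odd i then blockSeries b φ i else 1) := by
  refine eq_of_forall_reduceMod d _ _ fun N hN => ?_
  rw [map_mul, reduceMod_genSeries_top c hK hne hfin φ b N, ← map_mul,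
    ← prod_range_blockSeries_eq b φ hN hd, ← prod_range_blockSeries_eq b φ hN hd,
    ← expSeries_detSum_matrixPart b φ N fun i => ¬ Odd i, ← expSeries_detSum_matrixPart,
    superSeries_mul_det]

end GeneratingSeries

/-! ### From block series to the determinants of the statement. -/

section Determinants

variable {k : Type x} [Field k] {V : ℕ → Type w} [∀ i, AddCommGroup (V i)]
  [∀ i, Module k (V i)] {η : ℕ → Type*} [∀ i, Fintype (η i)] [∀ i, DecidableEq (η i)]

theorem evalNegHom_C {R : Type*} [CommRing R] (r : R) :
    PowerSeries.evalNegHom (PowerSeries.C r) = PowerSeries.C r := by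
  ext n
  rw [PowerSeries.evalNegHom, PowerSeries.coeff_rescale, PowerSeries.coeff_C]
  split_ifs with h <;> simp [h]

theorem algebraMap_eq_C_C (a : k) :
    algebraMap k (PowerSeries (PowerSeries k)) a = PowerSeries.C (PowerSeries.C a) := by
  rw [PowerSeries.algebraMap_apply]
  rfl

theorem detOneAdd_eq_blockSeries [CharZero k] (b : ∀ i, Module.Basis (η i) k (V i))
    (φ : ∀ i, Module.End k (V i)) (i : ℕ) :
    detOneAdd ((PowerSeries.C (PowerSeries.X : PowerSeries k)) ^ i * PowerSeries.X) (φ i) =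
      blockSeries b φ i := by
  rw [detOneAdd_eq_det (b i), blockSeries, expSeries_detSum]
  congr 1
  ext1 y z
  simp only [Matrix.add_apply, Matrix.smul_apply, Matrix.map_apply, weightedBlock, smul_eq_mul,
    map_mul, map_pow, algebraMap_eq_C_C]
  ring

theorem detOneAdd_neg_eq_blockSeries [CharZero k] (b : ∀ i, Module.Basis (η i) k (V i))
    (φ : ∀ i, Module.End k (V i)) (i : ℕ) :
    detOneAdd (-((PowerSeries.C (PowerSeries.X : PowerSeries k)) ^ i * PowerSeries.X)) (φ i) =
      PowerSeries.evalNegHom (blockSeries b φ i) := by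
  rw [← detOneAdd_eq_blockSeries, detOneAdd_eq_det (b i), detOneAdd_eq_det (b i), RingHom.map_det]
  congr 1
  ext1 y z
  have h1 : PowerSeries.evalNegHom ((1 : Matrix (η i) (η i) (PowerSeries (PowerSeries k))) y z) =
      (1 : Matrix (η i) (η i) (PowerSeries (PowerSeries k))) y z := by
    rw [Matrix.one_apply]
    split_ifs
    · exact map_one _
    · exact map_zero _
  simp only [Matrix.add_apply, Matrix.smul_apply, Matrix.map_apply, smul_eq_mul,
    map_mul, map_pow, map_add, algebraMap_eq_C_C, RingHom.mapMatrix_apply, evalNegHom_C,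
    PowerSeries.evalNegHom_X, h1]
  ring

/-- If `F · ∏_{i even} Dᵢ = ∏_{i odd} Dᵢ` then `F = ∏ᵢ Dᵢ^{-(-1)ⁱ}`. -/
theorem eq_prod_zpow_of_mul_eq {R : Type*} [CommRing R] (D : ℕ → Rˣ) (s : Finset ℕ) (F : R)
    (hF : F * ∏ i ∈ s, (if ¬ Odd i then (D i : R) else 1) =
      ∏ i ∈ s, if Odd i then (D i : R) else 1) :
    F = ((∏ i ∈ s, (D i)⁻¹ ^ ((-1 : ℤ) ^ i) : Rˣ) : R) := by
  have hcoe : ∀ q : ℕ → Prop, ∀ [DecidablePred q], ∏ i ∈ s, (if q i then (D i : R) else 1) =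
      ((∏ i ∈ s, if q i then D i else 1 : Rˣ) : R) := fun q _ => by
    rw [Units.coe_prod]
    refine Finset.prod_congr rfl fun i _ => ?_
    split_ifs <;> simp
  rw [hcoe, hcoe] at hF
  rw [← Units.eq_mul_inv_iff_mul_eq] at hF
  rw [hF, ← Units.val_mul]
  congr 1
  rw [mul_inv_eq_iff_eq_mul, ← Finset.prod_mul_distrib]
  refine Finset.prod_congr rfl fun i _ => ?_
  by_cases hi : Odd i
  · simp [hi, hi.neg_one_pow]
  · simp [hi, (Nat.not_odd_iff_even.mp hi).neg_one_pow]

/-- `F` is a product in the series `Eᵢ(-t)`. Substituting `t ↦ -t` gives `F(-t)` in terms of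
`Eᵢ(t)`, and its inverse `G` has all exponents negated, which turns `(-1)ⁱ` into `(-1)ⁱ⁺¹`. -/
theorem eq_prod_zpow_of_evalNegHom {R : Type*} [CommRing R] (E : ℕ → (PowerSeries R)ˣ)
    (s : Finset ℕ) (F G : PowerSeries R) (hG : G * PowerSeries.evalNegHom F = 1)
    (hF : F * PowerSeries.evalNegHom (∏ i ∈ s, if ¬ Odd i then (E i : PowerSeries R) else 1) =
      PowerSeries.evalNegHom (∏ i ∈ s, if Odd i then (E i : PowerSeries R) else 1)) :
    F = ((∏ i ∈ s, (Units.map (PowerSeries.evalNegHom : PowerSeries R →+* PowerSeries R).toMonoidHom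
        (E i))⁻¹ ^ ((-1 : ℤ) ^ i) : (PowerSeries R)ˣ) : PowerSeries R) ∧
      G = ((∏ i ∈ s, (E i)⁻¹ ^ ((-1 : ℤ) ^ (i + 1)) : (PowerSeries R)ˣ) : PowerSeries R) := by
  constructor
  · refine eq_prod_zpow_of_mul_eq _ s F ?_
    simp only [map_prod, apply_ite PowerSeries.evalNegHom, map_one] at hF
    exact hF
  · have h1 := congrArg PowerSeries.evalNegHom hF
    rw [map_mul, evalNegHom_evalNegHom, evalNegHom_evalNegHom] at h1
    rw [eq_prod_zpow_of_mul_eq E s _ h1] at hG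
    rw [← Units.inv_eq_of_mul_eq_one_left hG, ← Finset.prod_inv_distrib]
    congr 1
    refine Finset.prod_congr rfl fun i _ => ?_
    rw [pow_succ, mul_neg_one, zpow_neg]

end Determinants

theorem exists_bound_of_finite_total {k : Type x} [Field k] {C : Type u} [Category.{v} C]
    {H : Cᵒᵖ ⥤ GradedObject ℕ (ModuleCat.{w} k)} {η : ℕ → Type*} (X : C)
    (b : ∀ i, Module.Basis (η i) k (H.obj (op X) i)) [FiniteDimensional k (Total H X)] :
    ∃ d : ℕ, ∀ i > 2 * d, Subsingleton (H.obj (op X) i) := by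
  have hI : Finite (Σ i, η i) := Module.Finite.finite_basis (gradedBasis b)
  obtain ⟨d, hd⟩ := (Set.finite_range (Sigma.fst : (Σ i, η i) → ℕ)).bddAbove
  refine ⟨d, fun i hi => ?_⟩
  have : IsEmpty (η i) := ⟨fun y => by
    have : i ≤ d := hd ⟨⟨i, y⟩, rfl⟩
    -- All nonzero degrees are at most `d`, so the bound `2 * d` is met with room to spare.
    omega⟩
  exact (b i).repr.toEquiv.subsingleton

end

end KunnethCohomology

/-! ### The main theorem. -/

theorem corollary4p3 {C : Type u} [CategoryTheory.Category.{v} C]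
    [CategoryTheory.Limits.HasFiniteProducts C] {k : Type x} [Field k] [CharZero k]
    (H : Cᵒᵖ ⥤ GradedObject ℕ (ModuleCat.{w} k))
    (hne : ∃ (Y : C) (i : ℕ), Nontrivial (H.obj (op Y) i))
    (c : KunnethCohomology.CupProduct H) (hK : c.Kunneth)
    (hfin : ∀ (Y : C) (i : ℕ), FiniteDimensional k (H.obj (op Y) i))
    (X : C) (φ : ∀ i : ℕ, Module.End k (H.obj (op X) i)) :
    let u : PowerSeries (PowerSeries k) := PowerSeries.C PowerSeries.X
    let t : PowerSeries (PowerSeries k) := PowerSeries.X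
    let L : PowerSeries (PowerSeries k) := PowerSeries.C (KunnethCohomology.lefschetz φ)
    let S : PowerSeries (PowerSeries k) := KunnethCohomology.genSeries c hK φ fun _ => ⊤
    let A : PowerSeries (PowerSeries k) :=
      KunnethCohomology.genSeries c hK φ fun n => alternatingGroup (Fin n)
    (∃ W : (PowerSeries (PowerSeries k))ˣ,
      (W : PowerSeries (PowerSeries k)) = PowerSeries.evalNegHom S ∧
      A = S + ((W⁻¹ : (PowerSeries (PowerSeries k))ˣ) : PowerSeries (PowerSeries k)) - 1 - L * t) ∧
    (FiniteDimensional k (KunnethCohomology.Total H X) →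
      ∃ d : ℕ, ∀ i > 2 * d, Subsingleton (H.obj (op X) i)) ∧
    (∀ d : ℕ, (∀ i > 2 * d, Subsingleton (H.obj (op X) i)) →
      ∃ D E : ℕ → (PowerSeries (PowerSeries k))ˣ,
        (∀ i, (D i : PowerSeries (PowerSeries k)) =
          KunnethCohomology.detOneAdd (-(u ^ i * t)) (φ i)) ∧
        (∀ i, (E i : PowerSeries (PowerSeries k)) =
          KunnethCohomology.detOneAdd (u ^ i * t) (φ i)) ∧
        A = ((∏ i ∈ Finset.range (2 * d + 1), ((D i)⁻¹) ^ ((-1 : ℤ) ^ i) :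
              (PowerSeries (PowerSeries k))ˣ) : PowerSeries (PowerSeries k)) +
            ((∏ i ∈ Finset.range (2 * d + 1), ((E i)⁻¹) ^ ((-1 : ℤ) ^ (i + 1)) :
              (PowerSeries (PowerSeries k))ˣ) : PowerSeries (PowerSeries k)) - 1 - L * t) := by
  intro u t L S A
  let b : ∀ i, Module.Basis (Fin (Module.finrank k (H.obj (Opposite.op X) i))) k
      (H.obj (Opposite.op X) i) := fun i =>
    haveI := hfin X i
    Module.finBasis k _
  have hAS : (A - S + 1 + L * t) * PowerSeries.evalNegHom S = 1 :=
    KunnethCohomology.alternating_mul_evalNegHom c hK hne hfin φ b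
  -- The inverse of `S(-t)` is `A - S + 1 + L t` itself, so the first formula is a rearrangement.
  refine ⟨⟨⟨PowerSeries.evalNegHom S, A - S + 1 + L * t, by rw [mul_comm, hAS], hAS⟩, rfl, ?_⟩,
    fun hT => KunnethCohomology.exists_bound_of_finite_total X b, fun d hd => ?_⟩
  · change A = S + (A - S + 1 + L * t) - 1 - L * t
    ring
  · let E : ℕ → (PowerSeries (PowerSeries k))ˣ :=
      fun i => (KunnethCohomology.isUnit_blockSeries b φ i).unit
    obtain ⟨hS, hA⟩ := KunnethCohomology.eq_prod_zpow_of_evalNegHom E (Finset.range (2 * d + 1)) S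
      (A - S + 1 + L * t) hAS (KunnethCohomology.genSeries_top_mul_prod c hK hne hfin φ b (2 * d) hd)
    refine ⟨fun i => Units.map (PowerSeries.evalNegHom : PowerSeries (PowerSeries k) →+*
      PowerSeries (PowerSeries k)).toMonoidHom (E i), E, fun i => (KunnethCohomology.detOneAdd_neg_eq_blockSeries b φ i).symm,
      fun i => (KunnethCohomology.detOneAdd_eq_blockSeries b φ i).symm, ?_⟩
    rw [← hS, ← hA]
    ring
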